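/- Let $(R,\mathfrak m,k)$ be a Noetherian local ring, let $E$ be a finitely generated $R$-module having rank $e\ge 2$ (that is, $E\otimes_R Q\cong Q^e$ for the total ring of fractions $Q$ of $R$), and let $U=\sum_{i=1}^n Ra_i$ be a reduction of $E$. Here, for a finitely generated module $M$ over a Noetherian ring $A$, the Rees algebra $\mathcal R(M)$ is the symmetric algebra of $M$ modulo its $A$-torsion, with the induced grading; a submodule $V\subseteq M$ is a reduction of $M$ if, for some $r\ge 0$, $\mathcal R(M)_{r+1}=V\cdot\mathcal R(M)_r$, where $V$ acts through its image in $\mathcal R(M)_1$; and a reduction is minimal if it is minimal with respect to inclusion among the reductions of $M$. For a finitely generated module $M$ over a local ring, $\mu(M)$ denotes the minimal number of generators of $M$. Let $\mathbf Z=\{z_{ij}\mid 1\le i\le n,\ 1\le j\le e-1\}$ be indeterminates over $R$, let $R''=R(\mathbf Z)=R[\mathbf Z]_{\mathfrak mR[\mathbf Z]}$ be the Nagata extension, put $E''=E\otimes_RR''$ and $U''=U\otimes_RR''\subseteq E''$, and let $$x_j=\sum_{i=1}^n z_{ij}a_i\in U''\quad(1\le j\le e-1),\qquad F=\sum_{j=1}^{e-1}R''x_j\subseteq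 U'',\qquad \overline E=E''/F,\qquad \overline U=U''/F\subseteq\overline E .$$ Then $F$ is a free $R''$-module with basis $x_1,\dots,x_{e-1}$, and: (a) $\mu(\overline E)=\mu(E)-e+1$; (b) $\overline E$ is a free $R''$-module if and only if $E$ is a free $R$-module; (c) $\overline E$ has finite projective dimension over $R''$ if and only if $E$ has finite projective dimension over $R$; if this is the case, then $\operatorname{pd}_{R''}\overline E=\operatorname{pd}_R E$; (d) if, in addition, $E$ is torsionfree, $k$ is infinite, and $U$ is a minimal reduction of $E$, then $\overline U$ is a minimal reduction of $\overline E$. -/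

import Mathlib

open scoped TensorProduct

universe u

namespace GenericQuotient

section Rees

variable (R : Type*) [CommRing R] (M : Type*) [AddCommGroup M] [Module R M]

/-- `M` has rank `e`: over the total ring of fractions `Q` of `R`, the module `Q ⊗ M` is free of
rank `e`. -/
def HasRank (e : ℕ) : Prop :=
  Nonempty ((FractionRing R ⊗[R] M) ≃ₗ[FractionRing R] (Fin e → FractionRing R))

/-- The minimal number of generators of a finitely generated module. -/
noncomputable def mu : ℕ := (⊤ : Submodule R M).spanFinrank

/-- The `R`-torsion of the symmetric algebra of `M`, as an ideal. -/
def symTorsion : Ideal (SymmetricAlgebra R M) where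
  carrier := Submodule.torsion R (SymmetricAlgebra R M)
  add_mem' := fun ha hb => Submodule.add_mem _ ha hb
  zero_mem' := Submodule.zero_mem _
  smul_mem' := by
    rintro c x ⟨a, ha⟩
    refine ⟨a, ?_⟩
    simp only [Submonoid.smul_def, smul_eq_mul] at ha ⊢
    rw [← mul_smul_comm, ha, mul_zero]

/-- The Rees algebra of `M`: the symmetric algebra modulo its `R`-torsion. -/
def ReesAlg : Type _ := SymmetricAlgebra R M ⧸ symTorsion R M

noncomputable instance : CommRing (ReesAlg R M) :=
  inferInstanceAs (CommRing (SymmetricAlgebra R M ⧸ symTorsion R M))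

noncomputable instance : Algebra R (ReesAlg R M) :=
  inferInstanceAs (Algebra R (SymmetricAlgebra R M ⧸ symTorsion R M))

/-- The quotient map from the symmetric algebra to the Rees algebra. -/
noncomputable def reesMk : SymmetricAlgebra R M →ₐ[R] ReesAlg R M :=
  Ideal.Quotient.mkₐ R (symTorsion R M)

/-- The canonical map from `M` to its Rees algebra; its image is the degree one part. -/
noncomputable def reesMap : M →ₗ[R] ReesAlg R M :=
  (reesMk R M).toLinearMap ∘ₗ SymmetricAlgebra.ι R M

/-- The degree `n` part of the Rees algebra. The algebra is generated in degree one, so this is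
the `n`-th power of the degree one part (and the image of `R` if `n = 0`). -/
noncomputable def reesPiece (n : ℕ) : Submodule R (ReesAlg R M) :=
  (LinearMap.range (reesMap R M)) ^ n

variable {R M}

/-- `U` is a reduction of `M`: for some `r`, the degree `r + 1` part of the Rees algebra of `M` is
the product of the image of `U` in degree one and the degree `r` part. -/
def IsReduction (U : Submodule R M) : Prop :=
  ∃ r : ℕ, reesPiece R M (r + 1) = U.map (reesMap R M) * reesPiece R M r

/-- A reduction that is minimal with respect to inclusion among all reductions. -/
def IsMinimalReduction (U : Submodule R M) : Prop :=
  Minimal (fun V : Submodule R M => IsReduction V) U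

end Rees

section Nagata

variable (R : Type u) [CommRing R] [IsLocalRing R] (σ : Type)

/-- The extension of the maximal ideal to the polynomial ring. -/
noncomputable def extMax : Ideal (MvPolynomial σ R) :=
  (IsLocalRing.maximalIdeal R).map MvPolynomial.C

instance extMax_isPrime : (extMax R σ).IsPrime := by
  have h : IsDomain (MvPolynomial σ R ⧸ extMax R σ) :=
    (MvPolynomial.quotientEquivQuotientMvPolynomial (σ := σ)
      (IsLocalRing.maximalIdeal R)).symm.toMulEquiv.isDomain _
  exact (Ideal.Quotient.isDomain_iff_prime _).1 h

/-- The Nagata extension `R(Z)` of a local ring `R`, in variables `Z` indexed by `σ`: the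
localization of `R[Z]` at the extension of the maximal ideal of `R`. -/
def NagataExt : Type u := Localization.AtPrime (extMax R σ)

noncomputable instance : CommRing (NagataExt R σ) :=
  inferInstanceAs (CommRing (Localization.AtPrime (extMax R σ)))

noncomputable instance : Algebra (MvPolynomial σ R) (NagataExt R σ) :=
  inferInstanceAs (Algebra (MvPolynomial σ R) (Localization.AtPrime (extMax R σ)))

noncomputable instance : Algebra R (NagataExt R σ) :=
  inferInstanceAs (Algebra R (Localization.AtPrime (extMax R σ)))

instance : IsScalarTower R (MvPolynomial σ R) (NagataExt R σ) :=
  inferInstanceAs (IsScalarTower R (MvPolynomial σ R) (Localization.AtPrime (extMax R σ)))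

instance : IsLocalization.AtPrime (NagataExt R σ) (extMax R σ) :=
  inferInstanceAs (IsLocalization.AtPrime (Localization.AtPrime (extMax R σ)) (extMax R σ))

instance : IsLocalRing (NagataExt R σ) :=
  IsLocalization.AtPrime.isLocalRing (NagataExt R σ) (extMax R σ)

/-- The variable `z_s`, as an element of the Nagata extension. -/
noncomputable def nagataVar (s : σ) : NagataExt R σ :=
  algebraMap (MvPolynomial σ R) (NagataExt R σ) (MvPolynomial.X s)

end Nagata

section Construction

variable {R : Type u} [CommRing R] [IsLocalRing R] {E : Type u} [AddCommGroup E] [Module R E]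
  {n : ℕ} (e : ℕ) (a : Fin n → E)

/-- The variables `z_{ij}` with `i` among `n` and `j` among `e - 1` indices. -/
abbrev Idx (n e : ℕ) : Type := Fin n × Fin (e - 1)

/-- The generic elements `x_j = ∑ i, z_{ij} a_i` of `E''`, the base change of `E` to the Nagata
extension. -/
noncomputable def genElt (j : Fin (e - 1)) : NagataExt R (Idx n e) ⊗[R] E :=
  ∑ i : Fin n, nagataVar R (Idx n e) (i, j) ⊗ₜ[R] a i

/-- The submodule `F` of `E''` generated by the generic elements. -/
noncomputable def genF : Submodule (NagataExt R (Idx n e)) (NagataExt R (Idx n e) ⊗[R] E) :=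
  Submodule.span _ (Set.range (genElt (R := R) e a))

/-- The module `E'' / F`. -/
abbrev EBar : Type u := (NagataExt R (Idx n e) ⊗[R] E) ⧸ genF (R := R) e a

/-- The image `U'' / F` of `U''` in `E'' / F`, for `U` the submodule generated by the `a_i`. -/
noncomputable def UBar : Submodule (NagataExt R (Idx n e)) (EBar (R := R) e a) :=
  ((Submodule.span R (Set.range a)).baseChange (NagataExt R (Idx n e))).map
    (genF (R := R) e a).mkQ

/-- `F` is contained in `U''`. -/
theorem genF_le : genF (R := R) e a ≤
    (Submodule.span R (Set.range a)).baseChange (NagataExt R (Idx n e)) := by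
  refine Submodule.span_le.2 ?_
  rintro _ ⟨j, rfl⟩
  exact Submodule.sum_mem _ fun i _ =>
    Submodule.tmul_mem_baseChange_of_mem _ (Submodule.subset_span ⟨i, rfl⟩)

end Construction

/-- The projective dimension of an `R`-module, with value `⊤` if it is infinite. -/
noncomputable def projDim (R : Type u) [CommRing R] (M : Type u) [AddCommGroup M] [Module R M] :
    WithBot ℕ∞ :=
  CategoryTheory.projectiveDimension (ModuleCat.of R M)

end GenericQuotient

/-! Reductions are detected by points. If `V` is a reduction of `M`, each x in `M` has a power in
V·R(M)_r, so a map from the Rees algebra to a reduced ring that kills `V` kills `M`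
(`map_eq_zero_of_isReduction`). Conversely, `V` is a reduction once every x has a power in the ideal
generated by `V` (`isReduction_of_pow_mem`).

Over the total ring of fractions Q this shows that the a_i span Q^e; together with Nakayama, at
least e of them are independent in k ⊗ E. Generic combinations of such vectors are independent
(`eq_zero_of_generic_relation`), so the x_j are independent over R'' and also over its residue
field. Hence they form a basis of F and part of a minimal generating system of E''. Counting
generators gives (a); the sequence 0 → F → E'' → E''/F → 0 and faithful flatness of R → R'' give (b)
and (c).

For (d), U''/F is a reduction by `isReduction_of_map`. Suppose a reduction V of E''/F were properly
contained in it. A point of R(E)[Z] at which the polynomial elements over V vanish and the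
complement of mR[Z] does not should kill E (`map_eq_zero_of_isReduction_eBar`). Such a point kills
the x_j, but its field need not keep the regular elements of R'' regular, so it gives no point of
the Rees algebra of E''/F directly. It is first lifted: it factors through a domain D embedded in
κ[T_1,…,T_e], κ the residue field of a minimal prime of R, and solving x_j = 0 for one row of
variables gives a map from R'' to a localization of D[Z] that preserves regularity
(`exists_domain_factorization`). By prime avoidance, each g in E satisfies: s·g^m lies in the ideal
generated by the elements over V, for some s outside mR[Z]. As k is infinite, Z can be specialized
to R with the finitely many relevant polynomials becoming units. This yields a reduction of E inside
U, and minimality of U makes it equal to U, which contradicts V being proper. -/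

namespace GenericQuotient

/-! ### Rees algebras: universal property, grading, and detection of reductions by points. -/

section ReesLemmas

variable {A : Type*} [CommRing A] {M : Type*} [AddCommGroup M] [Module A M]
  {B : Type*} [CommRing B] [Algebra A B]

theorem reesMk_surjective : Function.Surjective (reesMk A M) :=
  Ideal.Quotient.mkₐ_surjective A (symTorsion A M)

theorem reesMk_eq_zero_iff (t : SymmetricAlgebra A M) :
    reesMk A M t = 0 ↔ ∃ s ∈ nonZeroDivisors A, s • t = 0 := by
  refine (Ideal.Quotient.eq_zero_iff_mem (I := symTorsion A M)).trans ?_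
  refine (Submodule.mem_torsion_iff t).trans ?_
  simp [Submonoid.smul_def]

theorem reesMap_apply (x : M) : reesMap A M x = reesMk A M (SymmetricAlgebra.ι A M x) := rfl

/-- The extension of a linear map to the Rees algebra, for a target on which the regular elements
of the base ring stay regular. -/
noncomputable def reesLift (h : ∀ s ∈ nonZeroDivisors A, algebraMap A B s ∈ nonZeroDivisors B)
    (f : M →ₗ[A] B) : ReesAlg A M →ₐ[A] B :=
  Ideal.Quotient.liftₐ (symTorsion A M) (SymmetricAlgebra.lift f) fun t ht => by
    obtain ⟨s, hs, hst⟩ := (reesMk_eq_zero_iff t).1 (Ideal.Quotient.eq_zero_iff_mem.2 ht)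
    have h1 := congrArg (SymmetricAlgebra.lift f) hst
    rw [map_smul, map_zero, Algebra.smul_def] at h1
    exact (mul_left_mem_nonZeroDivisors_eq_zero_iff (h s hs)).1 h1

theorem reesLift_mk (h : ∀ s ∈ nonZeroDivisors A, algebraMap A B s ∈ nonZeroDivisors B)
    (f : M →ₗ[A] B) (t : SymmetricAlgebra A M) :
    reesLift h f (reesMk A M t) = SymmetricAlgebra.lift f t := rfl

@[simp]
theorem reesLift_map (h : ∀ s ∈ nonZeroDivisors A, algebraMap A B s ∈ nonZeroDivisors B)
    (f : M →ₗ[A] B) (x : M) : reesLift h f (reesMap A M x) = f x := by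
  rw [reesMap_apply, reesLift_mk, SymmetricAlgebra.lift_ι_apply]

theorem algebraMap_reesAlg_mem_nonZeroDivisors (s : A) (hs : s ∈ nonZeroDivisors A) :
    algebraMap A (ReesAlg A M) s ∈ nonZeroDivisors (ReesAlg A M) := by
  rw [mem_nonZeroDivisors_iff_right]
  intro y hy
  obtain ⟨t, rfl⟩ := reesMk_surjective y
  rw [mul_comm, ← Algebra.smul_def, ← map_smul] at hy
  obtain ⟨s', hs', h⟩ := (reesMk_eq_zero_iff _).1 hy
  exact (reesMk_eq_zero_iff _).2 ⟨s' * s, mul_mem hs' hs, by rw [mul_smul, h]⟩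

theorem rees_induction {p : ReesAlg A M → Prop} (halg : ∀ r, p (algebraMap A _ r))
    (hι : ∀ x, p (reesMap A M x)) (hmul : ∀ y z, p y → p z → p (y * z))
    (hadd : ∀ y z, p y → p z → p (y + z)) (y : ReesAlg A M) : p y := by
  obtain ⟨t, rfl⟩ := reesMk_surjective y
  induction t using SymmetricAlgebra.induction with
  | algebraMap r => rw [AlgHom.commutes]; exact halg r
  | ι x => exact hι x
  | mul a b ha hb => rw [map_mul]; exact hmul _ _ ha hb
  | add a b ha hb => rw [map_add]; exact hadd _ _ ha hb

/-- The power x^(r+1) lies in V·R(M)_r, hence dies in `L`, and `L` is reduced. Two targets are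
needed: regular elements must stay regular in `B` for `f` to extend to the Rees algebra, while `L`
may be any point of `B`. -/
theorem map_eq_zero_of_isReduction
    (h : ∀ s ∈ nonZeroDivisors A, algebraMap A B s ∈ nonZeroDivisors B)
    {V : Submodule A M} (hV : IsReduction V) (f : M →ₗ[A] B)
    {L : Type*} [CommRing L] [IsReduced L] (g : B →+* L) (hg : ∀ v ∈ V, g (f v) = 0) (x : M) :
    g (f x) = 0 := by
  obtain ⟨r, hr⟩ := hV
  have hx : reesMap A M x ^ (r + 1) ∈ reesPiece A M (r + 1) :=
    Submodule.pow_mem_pow _ (LinearMap.mem_range_self _ x) _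
  rw [hr] at hx
  have key : ∀ y ∈ V.map (reesMap A M) * reesPiece A M r, g (reesLift h f y) = 0 := by
    intro y hy
    induction hy using Submodule.mul_induction_on' with
    | mem_mul_mem m hm n hn =>
      obtain ⟨v, hv, rfl⟩ := hm
      rw [map_mul, map_mul, reesLift_map, hg v hv, zero_mul]
    | add y _ z _ hy hz => rw [map_add, map_add, hy, hz, add_zero]
  have := key _ hx
  rw [map_pow, map_pow, reesLift_map] at this
  exact pow_eq_zero_iff (Nat.succ_ne_zero r) |>.1 this

theorem algebraMap_polynomial_mem_nonZeroDivisors (s : A) (hs : s ∈ nonZeroDivisors A) :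
    algebraMap A (Polynomial (ReesAlg A M)) s ∈ nonZeroDivisors (Polynomial (ReesAlg A M)) := by
  rw [mem_nonZeroDivisors_iff_right]
  intro y hy
  ext k
  have := congrArg (fun q => Polynomial.coeff q k) hy
  simp only [Polynomial.algebraMap_apply, Polynomial.coeff_mul_C, Polynomial.coeff_zero] at this
  exact (mem_nonZeroDivisors_iff_right.1 (algebraMap_reesAlg_mem_nonZeroDivisors s hs)) _ this

variable (A M) in
/-- The grading of the Rees algebra, as the coaction map to the polynomial ring. -/
noncomputable def reesGrading : ReesAlg A M →ₐ[A] Polynomial (ReesAlg A M) :=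
  reesLift algebraMap_polynomial_mem_nonZeroDivisors
    ((LinearMap.mulRight A Polynomial.X) ∘ₗ (Polynomial.CAlgHom.toLinearMap) ∘ₗ reesMap A M)

theorem reesGrading_map (x : M) :
    reesGrading A M (reesMap A M x) = Polynomial.C (reesMap A M x) * Polynomial.X := by
  rw [reesGrading, reesLift_map]
  simp

theorem coeff_reesGrading_mem (y : ReesAlg A M) (j : ℕ) :
    (reesGrading A M y).coeff j ∈ reesPiece A M j := by
  induction y using rees_induction generalizing j with
  | halg r =>
    rw [AlgHom.commutes, Polynomial.algebraMap_apply, Polynomial.coeff_C]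
    split_ifs with hj
    · subst hj
      rw [reesPiece, pow_zero]
      exact Submodule.algebraMap_mem r
    · exact zero_mem _
  | hι x =>
    rw [reesGrading_map, Polynomial.coeff_C_mul_X]
    split_ifs with hj
    · subst hj
      rw [reesPiece, pow_one]
      exact ⟨x, rfl⟩
    · exact zero_mem _
  | hmul y z hy hz =>
    rw [map_mul, Polynomial.coeff_mul]
    refine Submodule.sum_mem _ fun p hp => ?_
    rw [← Finset.HasAntidiagonal.mem_antidiagonal.1 hp, reesPiece, pow_add]
    exact Submodule.mul_mem_mul (hy _) (hz _)
  | hadd y z hy hz =>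
    rw [map_add, Polynomial.coeff_add]
    exact add_mem (hy j) (hz j)

theorem reesGrading_of_mem (m : ℕ) (y : ReesAlg A M) (hy : y ∈ reesPiece A M m) :
    reesGrading A M y = Polynomial.C y * Polynomial.X ^ m := by
  induction m generalizing y with
  | zero =>
    rw [reesPiece, pow_zero] at hy
    obtain ⟨r, rfl⟩ := Submodule.mem_one.1 hy
    rw [AlgHom.commutes, Polynomial.algebraMap_apply, pow_zero, mul_one]
  | succ m ih =>
    rw [reesPiece, pow_succ] at hy
    induction hy using Submodule.mul_induction_on' with
    | mem_mul_mem y hy z hz =>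
      obtain ⟨x, rfl⟩ := hz
      rw [map_mul, ih y hy, reesGrading_map, Polynomial.C_mul]
      ring
    | add y _ z _ hy hz => rw [map_add, hy, hz, Polynomial.C_add, add_mul]

theorem map_mul_reesPiece_le (V : Submodule A M) (m : ℕ) :
    V.map (reesMap A M) * reesPiece A M m ≤ reesPiece A M (m + 1) := by
  rw [reesPiece, reesPiece, pow_succ']
  exact mul_le_mul_left LinearMap.map_le_range _

/-- The degree one part generates a finitely generated ideal, so one of its powers lies in the ideal
generated by `V`. Taking components of degree m + 1 replaces membership in that ideal by membership
in V·R(M)_m. -/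
theorem isReduction_of_pow_mem [Module.Finite A M] (V : Submodule A M)
    (h : ∀ x : M, ∃ m : ℕ, reesMap A M x ^ m ∈ Ideal.span (reesMap A M '' V)) :
    IsReduction V := by
  set I := Ideal.span (reesMap A M '' (V : Set M)) with hI
  set J : Ideal (ReesAlg A M) := Ideal.span (LinearMap.range (reesMap A M) : Set _) with hJ
  have hJfg : J.FG := by
    obtain ⟨s, hs⟩ := Module.Finite.fg_top (R := A) (M := M)
    classical
    refine ⟨s.image (reesMap A M), ?_⟩
    apply le_antisymm
    · refine Ideal.span_mono ?_
      rw [Finset.coe_image]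
      exact Set.image_subset_range _ _
    · rw [hJ]
      refine Ideal.span_le.2 ?_
      rintro _ ⟨x, rfl⟩
      have hx : x ∈ Submodule.span A (s : Set M) := by rw [hs]; exact Submodule.mem_top
      induction hx using Submodule.span_induction with
      | mem x hx =>
        exact Ideal.subset_span (by rw [Finset.coe_image]; exact ⟨x, hx, rfl⟩)
      | zero => rw [map_zero]; exact zero_mem _
      | add x y _ _ hx hy => rw [map_add]; exact add_mem hx hy
      | smul c x _ hx =>
        rw [map_smul, Algebra.smul_def]
        exact Ideal.mul_mem_left _ _ hx
  have hJI : J ≤ I.radical := by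
    refine Ideal.span_le.2 ?_
    rintro _ ⟨x, rfl⟩
    exact h x
  obtain ⟨m, hm⟩ := Ideal.exists_pow_le_of_le_radical_of_fg hJI hJfg
  refine ⟨m, le_antisymm (fun y hy => ?_) (map_mul_reesPiece_le V m)⟩
  have hpow : ∀ k, ∀ y ∈ reesPiece A M k, y ∈ J ^ k := by
    intro k
    induction k with
    | zero => intro y _; rw [pow_zero, Ideal.one_eq_top]; exact Submodule.mem_top
    | succ k ih =>
      intro y hy
      rw [reesPiece, pow_succ] at hy
      rw [pow_succ]
      induction hy using Submodule.mul_induction_on' with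
      | mem_mul_mem y hy z hz => exact Ideal.mul_mem_mul (ih y hy) (Ideal.subset_span hz)
      | add y _ z _ hy hz => exact add_mem hy hz
  have hyI : y ∈ I := hm (Ideal.pow_le_pow_right (Nat.le_succ m) (hpow _ y hy))
  -- The arbitrary multiplier `c` is what lets the span induction pass through scalars of the Rees
  -- algebra.
  have key : ∀ z ∈ I, ∀ c, (reesGrading A M (c * z)).coeff (m + 1) ∈
      V.map (reesMap A M) * reesPiece A M m := by
    intro z hz
    induction hz using Submodule.span_induction with
    | mem z hz =>
      obtain ⟨v, hv, rfl⟩ := hz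
      intro c
      rw [map_mul, reesGrading_map, ← mul_assoc, Polynomial.coeff_mul_X, Polynomial.coeff_mul_C,
        mul_comm _ (reesMap A M v)]
      exact Submodule.mul_mem_mul (Submodule.mem_map_of_mem hv) (coeff_reesGrading_mem c m)
    | zero => intro c; simp
    | add y z _ _ hy hz =>
      intro c
      rw [mul_add, map_add, Polynomial.coeff_add]
      exact add_mem (hy c) (hz c)
    | smul d z _ hz =>
      intro c
      rw [smul_eq_mul, ← mul_assoc]
      exact hz _
  have := key y hyI 1
  rwa [one_mul, reesGrading_of_mem _ _ hy, Polynomial.coeff_C_mul_X_pow, if_pos rfl] at this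

end ReesLemmas

/-! ### Functionals detecting proper submodules, and independence of generic combinations. -/

section LinearAlgebra

theorem exists_linearMap_quotient_maximal {A : Type*} [CommRing A] {M : Type*} [AddCommGroup M]
    [Module A M] [Module.Finite A M] (V : Submodule A M) (hV : V ≠ ⊤) :
    ∃ 𝔫 : Ideal A, 𝔫.IsMaximal ∧ ∃ f : M →ₗ[A] A ⧸ 𝔫, f ≠ 0 ∧ V ≤ LinearMap.ker f := by
  obtain ⟨W, hW, hVW⟩ := (eq_top_or_exists_le_coatom V).resolve_left hV
  have hs : IsSimpleModule A (M ⧸ W) := isSimpleModule_iff_isCoatom.2 hW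
  obtain ⟨𝔫, h𝔫, ⟨g⟩⟩ := isSimpleModule_iff_quot_maximal.1 hs
  refine ⟨𝔫, h𝔫, g.toLinearMap ∘ₗ W.mkQ, fun h => hW.1 ?_, fun v hv => ?_⟩
  · refine eq_top_iff.2 fun x _ => ?_
    have := LinearMap.congr_fun h x
    simpa using this
  · simpa using hVW hv

open MvPolynomial in
/-- Generic combinations, with indeterminate coefficients, of vectors whose span contains a
linearly independent family with the same index set, are linearly independent. -/
theorem eq_zero_of_generic_relation {K : Type*} [CommRing K] {ι J L : Type*} [Fintype ι]
    [Fintype J] (v : ι → L → K) (c : J → ι → K)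
    (hc : LinearIndependent K (fun j l => ∑ i, c j i * v i l))
    (r : J → MvPolynomial (ι × J) K)
    (h : ∀ l, ∑ j, ∑ i, r j * X (i, j) * C (v i l) = 0) (j : J) : r j = 0 := by
  have hind : ∀ s : J → MvPolynomial (ι × J) K,
      (∀ l, ∑ j, ∑ i, s j * C (c j i) * C (v i l) = 0) → ∀ j, s j = 0 := by
    intro s hs j
    ext m
    refine Fintype.linearIndependent_iff.1 hc (fun j => coeff m (s j)) ?_ j
    funext l
    have := congrArg (coeff m) (hs l)
    simp only [coeff_sum, coeff_zero, mul_assoc, mul_comm (s _), coeff_C_mul] at this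
    simpa [Finset.mul_sum, mul_comm, mul_left_comm, mul_assoc] using this
  -- The translation z_ij ↦ z_ij + T c_ji moves the generic combinations towards the given
  -- independent family; T = 0 recovers the original polynomials.
  let φ : MvPolynomial (ι × J) K →ₐ[K] Polynomial (MvPolynomial (ι × J) K) :=
    aeval fun p => Polynomial.C (X p) + Polynomial.X * Polynomial.C (C (c p.2 p.1))
  have hφC : ∀ x, φ (C x) = Polynomial.C (C x) := fun x => by
    rw [← algebraMap_eq, AlgHom.commutes]; rfl
  have hφ0 : ∀ p, (φ p).coeff 0 = p := by
    intro p
    have : (Polynomial.constantCoeff.comp φ.toRingHom) = RingHom.id _ := by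
      apply MvPolynomial.ringHom_ext
      · intro x
        change Polynomial.constantCoeff (φ (C x)) = _
        rw [hφC]; simp
      · intro i
        change Polynomial.constantCoeff (φ (X i)) = _
        simp [φ]
    exact RingHom.congr_fun this p
  have hrel : ∀ l, ∑ j, ∑ i, φ (r j) * (Polynomial.C (X (i, j)) +
      Polynomial.X * Polynomial.C (C (c j i))) * Polynomial.C (C (v i l)) = 0 := by
    intro l
    have := congrArg φ (h l)
    simpa only [map_sum, map_mul, hφC, map_zero, φ, aeval_X] using this
  -- In the coefficient of T^(d+1) only the T c_ji terms survive, which is a relation among the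
  -- independent family. Descending from large degree then kills every coefficient.
  have hstep : ∀ d, (∀ j, (φ (r j)).coeff (d + 1) = 0) → ∀ j, (φ (r j)).coeff d = 0 := by
    intro d hd
    refine hind _ fun l => ?_
    have := congrArg (fun q => Polynomial.coeff q (d + 1)) (hrel l)
    simpa [Polynomial.finsetSum_coeff, mul_add, add_mul, ← mul_assoc, hd] using this
  obtain ⟨n, hn⟩ : ∃ n, ∀ j, (φ (r j)).natDegree < n := by
    obtain ⟨n, hn⟩ := (Set.finite_range fun j => (φ (r j)).natDegree).bddAbove
    exact ⟨n + 1, fun j => Nat.lt_succ_of_le (hn ⟨j, rfl⟩)⟩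
  have h0 : ∀ j, (φ (r j)).coeff 0 = 0 :=
    Nat.decreasingInduction (motive := fun d _ => ∀ j, (φ (r j)).coeff d = 0)
      (fun d _ hd => hstep d hd)
      (fun j => Polynomial.coeff_eq_zero_of_natDegree_lt (hn j)) (Nat.zero_le n)
  rw [← hφ0 (r j), h0]

end LinearAlgebra

/-! ### Modules of rank e over the total ring of fractions. -/

section Rank

variable {R : Type*} [CommRing R] {E : Type*} [AddCommGroup E] [Module R E] {e : ℕ}

/-- The coordinates of the elements of a module of rank `e`, over the total ring of fractions. -/
noncomputable def rankCoord (h : (FractionRing R ⊗[R] E) ≃ₗ[FractionRing R]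
    (Fin e → FractionRing R)) : E →ₗ[R] (Fin e → FractionRing R) :=
  (h.toLinearMap.restrictScalars R) ∘ₗ TensorProduct.mk R (FractionRing R) E 1

variable (h : (FractionRing R ⊗[R] E) ≃ₗ[FractionRing R] (Fin e → FractionRing R))

theorem rankCoord_apply (x : E) : rankCoord h x = h (1 ⊗ₜ x) := rfl

theorem span_range_rankCoord :
    Submodule.span (FractionRing R) (Set.range (rankCoord h)) = ⊤ := by
  refine eq_top_iff.2 fun y _ => ?_
  obtain ⟨t, rfl⟩ := h.surjective y
  induction t using TensorProduct.induction_on with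
  | zero => rw [map_zero]; exact zero_mem _
  | add s t hs ht => rw [map_add]; exact add_mem (hs trivial) (ht trivial)
  | tmul q x =>
    rw [show q ⊗ₜ[R] x = q • ((1 : FractionRing R) ⊗ₜ[R] x) by simp [TensorProduct.smul_tmul'],
      map_smul]
    exact Submodule.smul_mem _ _ (Submodule.subset_span ⟨x, rfl⟩)

/-- Otherwise a nonzero functional Q^e → Q/𝔫 kills `V`. Regular elements of `R` are units in Q/𝔫, so
this is a point of the Rees algebra; it kills all of `E`, which spans Q^e. -/
theorem span_rankCoord_of_isReduction {V : Submodule R E} (hV : IsReduction V) :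
    Submodule.span (FractionRing R) (rankCoord h '' V) = ⊤ := by
  by_contra hne
  obtain ⟨𝔫, h𝔫, f, hf, hVf⟩ := exists_linearMap_quotient_maximal _ hne
  let f' : E →ₗ[R] FractionRing R ⧸ 𝔫 := (f.restrictScalars R) ∘ₗ rankCoord h
  have hreg : ∀ s ∈ nonZeroDivisors R, algebraMap R (FractionRing R ⧸ 𝔫) s ∈
      nonZeroDivisors (FractionRing R ⧸ 𝔫) := by
    intro s hs
    rw [IsScalarTower.algebraMap_apply R (FractionRing R) (FractionRing R ⧸ 𝔫)]
    exact ((IsLocalization.map_units (FractionRing R) ⟨s, hs⟩).map _).mem_nonZeroDivisors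
  have := h𝔫.isPrime
  have h0 : ∀ x, f' x = 0 := map_eq_zero_of_isReduction hreg hV f' (RingHom.id _) fun v hv =>
    hVf (Submodule.subset_span ⟨v, hv, rfl⟩)
  refine hf (LinearMap.ext_on_range (span_range_rankCoord h) fun x => ?_)
  exact h0 x

theorem span_rankCoord_range {ι : Type*} {a : ι → E}
    (hV : IsReduction (Submodule.span R (Set.range a))) :
    Submodule.span (FractionRing R) (Set.range fun i => rankCoord h (a i)) = ⊤ := by
  rw [eq_top_iff, ← span_rankCoord_of_isReduction h hV]
  refine Submodule.span_le.2 ?_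
  rintro _ ⟨v, hv, rfl⟩
  induction hv using Submodule.span_induction with
  | mem v hv => obtain ⟨i, rfl⟩ := hv; exact Submodule.subset_span ⟨i, rfl⟩
  | zero => rw [map_zero]; exact zero_mem _
  | add v w _ _ hv hw => rw [map_add]; exact add_mem hv hw
  | smul c v _ hv =>
    rw [map_smul, ← algebraMap_smul (FractionRing R)]
    exact Submodule.smul_mem _ _ hv

theorem exists_coeff_rankCoord {ι : Type*} [Fintype ι] {a : ι → E}
    (hV : IsReduction (Submodule.span R (Set.range a))) (y : Fin e → FractionRing R) :
    ∃ c : ι → FractionRing R, ∀ l, ∑ i, c i * rankCoord h (a i) l = y l := by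
  have : y ∈ Submodule.span (FractionRing R) (Set.range fun i => rankCoord h (a i)) := by
    rw [span_rankCoord_range h hV]; trivial
  obtain ⟨c, hc⟩ := (Submodule.mem_span_range_iff_exists_fun _).1 this
  exact ⟨c, fun l => by rw [← hc]; simp⟩

theorem rank_le_card_of_isReduction [Nontrivial R] {ι : Type*} [Fintype ι] {a : ι → E}
    (hE : HasRank R E e) (hV : IsReduction (Submodule.span R (Set.range a))) :
    e ≤ Fintype.card ι := by
  obtain ⟨h⟩ := hE
  have hs : Function.Surjective
      (Fintype.linearCombination (FractionRing R) fun i => rankCoord h (a i)) := by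
    rw [← LinearMap.range_eq_top, Fintype.range_linearCombination, span_rankCoord_range h hV]
  have : Nontrivial (FractionRing R) :=
    (IsLocalization.injective (FractionRing R) (le_refl (nonZeroDivisors R))).nontrivial
  simpa using card_le_of_surjective (FractionRing R) _ hs

end Rank

/-! ### The Nagata extension: faithful flatness, denominators, specialization of the variables. -/

section NagataLemmas

variable {R : Type u} [CommRing R] [IsLocalRing R] {σ : Type}

instance [IsNoetherianRing R] [Finite σ] : IsNoetherianRing (NagataExt R σ) :=
  IsLocalization.isNoetherianRing (extMax R σ).primeCompl _ inferInstance

instance : Module.Flat R (NagataExt R σ) :=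
  have : Module.Flat (MvPolynomial σ R) (NagataExt R σ) :=
    IsLocalization.flat _ (extMax R σ).primeCompl
  Module.Flat.trans R (MvPolynomial σ R) _

theorem C_mem_extMax {r : R} :
    MvPolynomial.C r ∈ extMax R σ ↔ r ∈ IsLocalRing.maximalIdeal R := by
  classical
  rw [extMax, MvPolynomial.mem_map_C_iff]
  refine ⟨fun h => by simpa using h 0, fun h m => ?_⟩
  rw [MvPolynomial.coeff_C]
  split_ifs
  exacts [h, zero_mem _]

theorem algebraMap_mem_maximalIdeal_nagata {p : MvPolynomial σ R} :
    algebraMap _ (NagataExt R σ) p ∈ IsLocalRing.maximalIdeal (NagataExt R σ) ↔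
      p ∈ extMax R σ :=
  IsLocalization.AtPrime.to_map_mem_maximal_iff (NagataExt R σ) (extMax R σ) p

theorem isUnit_algebraMap_nagata {p : MvPolynomial σ R} (hp : p ∉ extMax R σ) :
    IsUnit (algebraMap _ (NagataExt R σ) p) :=
  IsLocalization.map_units (NagataExt R σ) (⟨p, hp⟩ : (extMax R σ).primeCompl)

theorem algebraMap_nagata_apply (r : R) : algebraMap R (NagataExt R σ) r =
    algebraMap (MvPolynomial σ R) (NagataExt R σ) (MvPolynomial.C r) :=
  IsScalarTower.algebraMap_apply R (MvPolynomial σ R) (NagataExt R σ) r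

instance : IsLocalHom (algebraMap R (NagataExt R σ)) where
  map_nonunit r hr := by
    by_contra h
    refine (IsLocalRing.mem_maximalIdeal _).1 ?_ hr
    rw [algebraMap_nagata_apply, algebraMap_mem_maximalIdeal_nagata, C_mem_extMax]
    exact h

instance : Module.FaithfullyFlat R (NagataExt R σ) :=
  Module.FaithfullyFlat.of_flat_of_isLocalHom

theorem algebraMap_nagata_injective : Function.Injective (algebraMap R (NagataExt R σ)) :=
  FaithfulSMul.algebraMap_injective R (NagataExt R σ)

theorem algebraMap_nagata_mem_nonZeroDivisors (s : R) (hs : s ∈ nonZeroDivisors R) :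
    algebraMap R (NagataExt R σ) s ∈ nonZeroDivisors (NagataExt R σ) := by
  have := Module.Flat.isSMulRegular_of_nonZeroDivisors (M := NagataExt R σ) hs
  rw [mem_nonZeroDivisors_iff_right]
  intro y hy
  refine this ?_
  change s • y = s • 0
  rw [smul_zero, Algebra.smul_def, mul_comm, hy]

/-- Finitely many elements of the Nagata extension have a common denominator. -/
theorem exists_nagata_denominator {J : Type*} [Finite J] (r : J → NagataExt R σ) :
    ∃ s ∉ extMax R σ, ∃ p : J → MvPolynomial σ R,
      ∀ j, algebraMap _ (NagataExt R σ) s * r j = algebraMap _ _ (p j) := by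
  obtain ⟨s, hs⟩ := IsLocalization.exist_integer_multiples_of_finite (extMax R σ).primeCompl r
  choose p hp using hs
  exact ⟨s, s.2, p, fun j => by rw [hp j, Algebra.smul_def]⟩

/-- Evaluating the indeterminates in `R` and reducing modulo the maximal ideal of `R` kills the
extended maximal ideal. -/
theorem eval_mem_maximalIdeal (ζ : σ → R) {p : MvPolynomial σ R} (hp : p ∈ extMax R σ) :
    MvPolynomial.eval ζ p ∈ IsLocalRing.maximalIdeal R := by
  have : extMax R σ ≤ (IsLocalRing.maximalIdeal R).comap (MvPolynomial.eval ζ) := by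
    refine Ideal.map_le_iff_le_comap.2 fun r hr => ?_
    simpa using hr
  exact this hp

theorem mem_extMax_iff_map_residue {p : MvPolynomial σ R} :
    p ∈ extMax R σ ↔ MvPolynomial.map (IsLocalRing.residue R) p = 0 := by
  rw [extMax, MvPolynomial.mem_map_C_iff, MvPolynomial.ext_iff]
  simp [MvPolynomial.coeff_map, IsLocalRing.residue_eq_zero_iff]

theorem exists_eval_notMem_maximalIdeal [Infinite (IsLocalRing.ResidueField R)]
    {p : MvPolynomial σ R} (hp : p ∉ extMax R σ) :
    ∃ ζ : σ → R, MvPolynomial.eval ζ p ∉ IsLocalRing.maximalIdeal R := by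
  rw [mem_extMax_iff_map_residue] at hp
  by_contra! h
  refine hp (MvPolynomial.funext fun x => ?_)
  obtain ⟨ζ, hζ⟩ : ∃ ζ : σ → R, (fun i => IsLocalRing.residue R (ζ i)) = x :=
    ⟨fun i => (IsLocalRing.residue_surjective (x i)).choose,
      funext fun i => (IsLocalRing.residue_surjective (x i)).choose_spec⟩
  have h1 := (IsLocalRing.residue_eq_zero_iff _).2 (h ζ)
  rw [map_zero, ← hζ]
  rw [← h1, MvPolynomial.eval_map, MvPolynomial.eval, MvPolynomial.coe_eval₂Hom,
    MvPolynomial.hom_eval₂]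
  rfl

end NagataLemmas

/-! ### Freeness of F. -/

section Freeness

variable {R : Type u} [CommRing R] [IsLocalRing R] {E : Type u} [AddCommGroup E] [Module R E]
  {n : ℕ} (e : ℕ) (a : Fin n → E)

theorem liftBaseChange_genElt {B : Type*} [CommRing B] [Algebra R B]
    [Algebra (NagataExt R (Idx n e)) B] [IsScalarTower R (NagataExt R (Idx n e)) B]
    (f : E →ₗ[R] B) (j : Fin (e - 1)) :
    f.liftBaseChange (NagataExt R (Idx n e)) (genElt (R := R) e a j) =
      ∑ i, algebraMap _ B (nagataVar R (Idx n e) (i, j)) * f (a i) := by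
  simp [genElt, Algebra.smul_def]

/-- After clearing denominators and taking coordinates, a relation among the x_j becomes a
polynomial relation over Q among generic combinations of vectors spanning Q^e. -/
theorem linearIndependent_genElt (hE : HasRank R E e)
    (hU : IsReduction (Submodule.span R (Set.range a))) :
    LinearIndependent (NagataExt R (Idx n e)) (genElt (R := R) e a) := by
  obtain ⟨h⟩ := hE
  let Q := FractionRing R
  -- Inverting this set in Q[Z] gives an R''-algebra `B` that receives the coordinates of E''.
  let S : Submonoid (MvPolynomial (Idx n e) Q) :=
    (extMax R (Idx n e)).primeCompl.map (MvPolynomial.map (algebraMap R Q))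
  obtain ⟨B, _, _, _⟩ : ∃ (B : Type u) (_ : CommRing B)
      (_ : Algebra (MvPolynomial (Idx n e) Q) B), IsLocalization S B :=
    ⟨Localization S, inferInstance, inferInstance, inferInstance⟩
  let g : NagataExt R (Idx n e) →+* B :=
    IsLocalization.map B (MvPolynomial.map (algebraMap R Q))
      (M := (extMax R (Idx n e)).primeCompl) (T := S) (Submonoid.le_comap_map _)
  have hg : ∀ p, g (algebraMap _ _ p) =
      algebraMap (MvPolynomial (Idx n e) Q) B (MvPolynomial.map (algebraMap R Q) p) := fun p =>
    IsLocalization.map_eq _ p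
  let i0 : Algebra R B :=
    ((algebraMap (MvPolynomial (Idx n e) Q) B).comp (algebraMap R _)).toAlgebra
  have : IsScalarTower R (MvPolynomial (Idx n e) Q) B := IsScalarTower.of_algebraMap_eq fun _ => rfl
  let i1 : Algebra (NagataExt R (Idx n e)) B := g.toAlgebra
  have i2 : IsScalarTower R (NagataExt R (Idx n e)) B := IsScalarTower.of_algebraMap_eq fun r => by
    rw [algebraMap_nagata_apply]
    change _ = g _
    rw [hg, MvPolynomial.map_C, IsScalarTower.algebraMap_apply R (MvPolynomial (Idx n e) Q) B]
    rfl
  let f : Fin e → E →ₗ[R] B := fun l =>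
    (IsScalarTower.toAlgHom R (MvPolynomial (Idx n e) Q) B).toLinearMap ∘ₗ
      (IsScalarTower.toAlgHom R Q (MvPolynomial (Idx n e) Q)).toLinearMap ∘ₗ
      LinearMap.proj l ∘ₗ rankCoord h
  have hf : ∀ l x, f l x = algebraMap (MvPolynomial (Idx n e) Q) B
      (MvPolynomial.C (rankCoord h x l)) := fun l x => rfl
  rw [Fintype.linearIndependent_iff]
  intro r hr j
  obtain ⟨s, hs, p, hp⟩ := exists_nagata_denominator r
  have h1 : ∀ l, algebraMap (MvPolynomial (Idx n e) Q) B
      (∑ j, ∑ i, MvPolynomial.map (algebraMap R Q) (p j) * MvPolynomial.X (i, j) *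
        MvPolynomial.C (rankCoord h (a i) l)) = 0 := by
    intro l
    have hl := liftBaseChange_genElt e a (f l)
    have := congrArg ((f l).liftBaseChange (NagataExt R (Idx n e)))
      (congrArg (algebraMap _ (NagataExt R (Idx n e)) s • ·) hr)
    simp only [Finset.smul_sum, smul_smul, hp, smul_zero, map_zero, map_sum, map_smul, hl] at this
    rw [← this, map_sum]
    refine Finset.sum_congr rfl fun j _ => ?_
    rw [map_sum]
    refine Finset.sum_congr rfl fun i _ => ?_
    rw [Algebra.smul_def, map_mul, map_mul, mul_assoc, hf]
    change _ = g _ * (g _ * _)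
    rw [hg, nagataVar, hg, MvPolynomial.map_X]
  have h2 : ∀ l, ∃ t : S, t.1 *
      (∑ j, ∑ i, MvPolynomial.map (algebraMap R Q) (p j) * MvPolynomial.X (i, j) *
        MvPolynomial.C (rankCoord h (a i) l)) = 0 := fun l =>
    (IsLocalization.map_eq_zero_iff S B _).1 (h1 l)
  choose t ht using h2
  -- One multiplier from outside mR[Z] serves all coordinates; it becomes a unit in R'' and is
  -- cancelled at the end.
  obtain ⟨t₀, ht₀, htt⟩ := (∏ l, t l).2
  -- The comparison family for the generic relation: the first e - 1 unit vectors of Q^e.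
  choose c hc using fun j : Fin (e - 1) => exists_coeff_rankCoord h hU
    (Pi.single (Fin.castLE (Nat.sub_le e 1) j) 1)
  have h3 := eq_zero_of_generic_relation (fun i l => rankCoord h (a i) l) c
    (by
      have : (fun j l => ∑ i, c j i * rankCoord h (a i) l) =
          fun j => Pi.single (Fin.castLE (Nat.sub_le e 1) j) 1 :=
        funext fun j => funext fun l => hc j l
      rw [this]
      exact (Pi.linearIndependent_single_one (Fin e) Q).comp _ (Fin.castLE_injective _))
    (fun j => MvPolynomial.map (algebraMap R Q) (t₀ * p j))
    (fun l => by
      have h4 : MvPolynomial.map (algebraMap R Q) t₀ *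
          (∑ j, ∑ i, MvPolynomial.map (algebraMap R Q) (p j) * MvPolynomial.X (i, j) *
            MvPolynomial.C (rankCoord h (a i) l)) = 0 := by
        rw [htt, Submonoid.coe_finsetProd, ← Finset.mul_prod_erase _ _ (Finset.mem_univ l),
          mul_right_comm, ht l, zero_mul]
      rw [← h4, Finset.mul_sum]
      refine Finset.sum_congr rfl fun j _ => ?_
      rw [Finset.mul_sum]
      refine Finset.sum_congr rfl fun i _ => ?_
      rw [map_mul]
      ring) j
  have h5 : t₀ * p j = 0 := by
    refine MvPolynomial.map_injective _ (IsFractionRing.injective R Q) ?_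
    rw [h3, map_zero]
  have h6 := congrArg (algebraMap _ (NagataExt R (Idx n e))) h5
  rw [map_mul, map_zero, ← hp] at h6
  exact (isUnit_algebraMap_nagata hs).mul_right_eq_zero.1
    ((isUnit_algebraMap_nagata ht₀).mul_right_eq_zero.1 h6)

end Freeness

/-! ### Independence of the x_j modulo the maximal ideal. -/

section ResidueIndependence

variable {R : Type u} [CommRing R] [IsLocalRing R] {E : Type u} [AddCommGroup E] [Module R E]

theorem liftBaseChange_residue_genElt {e n : ℕ} (a : Fin n → E)
    (f : E →ₗ[R] IsLocalRing.ResidueField R) (j : Fin (e - 1)) :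
    (((IsScalarTower.toAlgHom R (IsLocalRing.ResidueField R)
        (IsLocalRing.ResidueField (NagataExt R (Idx n e)))).toLinearMap ∘ₗ f).liftBaseChange
      (NagataExt R (Idx n e))).liftBaseChange (IsLocalRing.ResidueField (NagataExt R (Idx n e)))
      ((1 : IsLocalRing.ResidueField (NagataExt R (Idx n e))) ⊗ₜ[NagataExt R (Idx n e)]
        genElt (R := R) e a j) =
    ∑ i, IsLocalRing.residue _ (nagataVar R (Idx n e) (i, j)) *
      algebraMap (IsLocalRing.ResidueField R) _ (f (a i)) := by
  rw [LinearMap.liftBaseChange_tmul, one_smul]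
  exact liftBaseChange_genElt e a _ j

variable [Module.Finite R E]

instance (m : ℕ) : Module.Finite R (reesPiece R E m) :=
  Module.Finite.iff_fg.2 (Submodule.FG.pow (by
    rw [LinearMap.range_eq_map]; exact Module.Finite.fg_top.map _) m)

/-- Nakayama for the finitely generated module R(E)_(r+1), which is contained in V·R(E)_r +
m·R(E)_(r+1). -/
theorem isReduction_of_le_sup_smul {U V : Submodule R E} (hU : IsReduction U)
    (h : U ≤ V ⊔ IsLocalRing.maximalIdeal R • ⊤) : IsReduction V := by
  obtain ⟨r, hr⟩ := hU
  refine ⟨r, le_antisymm ?_ (map_mul_reesPiece_le V r)⟩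
  refine Submodule.le_of_le_smul_of_le_jacobson_bot (Module.Finite.iff_fg.1 inferInstance)
    (IsLocalRing.maximalIdeal_le_jacobson ⊥) ?_
  rw [hr]
  refine Submodule.mul_le.2 ?_
  rintro _ ⟨u, hu, rfl⟩ y hy
  obtain ⟨v, hv, w, hw, rfl⟩ := Submodule.mem_sup.1 (h hu)
  rw [← hr, map_add, add_mul]
  refine Submodule.add_mem_sup (Submodule.mul_mem_mul (Submodule.mem_map_of_mem hv) hy) ?_
  clear hu hr
  induction hw using Submodule.smul_induction_on' with
  | smul c hc x _ =>
    rw [map_smul, smul_mul_assoc]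
    exact Submodule.smul_mem_smul hc (map_mul_reesPiece_le ⊤ r
      (Submodule.mul_mem_mul (Submodule.mem_map_of_mem trivial) hy))
  | add x _ z _ hx hz => rw [map_add, add_mul]; exact add_mem hx hz

/-- Among the generators of a reduction there are at least `e`, for `e` the rank, that are
linearly independent modulo the maximal ideal. -/
theorem exists_linearIndependent_residue {e : ℕ} (hE : HasRank R E e) {n : ℕ} (a : Fin n → E)
    (hU : IsReduction (Submodule.span R (Set.range a))) :
    ∃ s : Fin e → Fin n, LinearIndependent (IsLocalRing.ResidueField R)
      (fun j => (1 : IsLocalRing.ResidueField R) ⊗ₜ[R] a (s j)) := by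
  let k := IsLocalRing.ResidueField R
  obtain ⟨κ, s, hs, hspan, hind⟩ :=
    exists_linearIndependent' k (fun i => (1 : k) ⊗ₜ[R] a i)
  have : Finite κ := Finite.of_injective s hs
  have := Fintype.ofFinite κ
  -- The selected a_i form a basis, modulo m, of the span of all of them. They still generate a
  -- reduction, so the rank bounds their number from below.
  have hred : IsReduction (Submodule.span R (Set.range (a ∘ s))) := by
    refine isReduction_of_le_sup_smul hU (Submodule.span_le.2 ?_)
    rintro _ ⟨i, rfl⟩
    have h1 : (1 : k) ⊗ₜ[R] a i ∈ Submodule.span k (Set.range ((fun i => (1 : k) ⊗ₜ[R] a i) ∘ s)) := by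
      rw [hspan]; exact Submodule.subset_span ⟨i, rfl⟩
    obtain ⟨c, hc⟩ := (Submodule.mem_span_range_iff_exists_fun k).1 h1
    choose c' hc' using fun j => IsLocalRing.residue_surjective (c j)
    have h2 : (1 : k) ⊗ₜ[R] (a i - ∑ j, c' j • a (s j)) = 0 := by
      rw [TensorProduct.tmul_sub, ← hc, TensorProduct.tmul_sum, ← Finset.sum_sub_distrib]
      refine Finset.sum_eq_zero fun j _ => ?_
      rw [TensorProduct.tmul_smul, ← hc' j]
      exact sub_self _
    have h3 : a i - ∑ j, c' j • a (s j) ∈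
        (IsLocalRing.maximalIdeal R • ⊤ : Submodule R E) := by
      have h5 := congrArg (TensorProduct.quotTensorEquivQuotSMul E (IsLocalRing.maximalIdeal R)) h2
      have h6 := TensorProduct.quotTensorEquivQuotSMul_mk_tmul (IsLocalRing.maximalIdeal R) 1
        (a i - ∑ j, c' j • a (s j))
      rw [one_smul] at h6
      exact (Submodule.Quotient.mk_eq_zero _).1 (h6.symm.trans (h5.trans (map_zero (TensorProduct.quotTensorEquivQuotSMul E _))))
    have h4 : a i = ∑ j, c' j • a (s j) + (a i - ∑ j, c' j • a (s j)) := by abel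
    rw [SetLike.mem_coe, h4]
    refine Submodule.add_mem_sup (Submodule.sum_mem _ fun j _ => ?_) h3
    exact Submodule.smul_mem _ _ (Submodule.subset_span ⟨j, rfl⟩)
  have hcard := rank_le_card_of_isReduction hE hred
  obtain ⟨t⟩ := Function.Embedding.nonempty_of_card_le (α := Fin e) (β := κ)
    (by rwa [Fintype.card_fin])
  exact ⟨fun j => s (t j), hind.comp t t.injective⟩

/-- The generic relation argument over k, with coordinates in a basis of k ⊗ E. The comparison
family consists of e - 1 of the a_i that are independent modulo m. -/
theorem linearIndependent_residue_genElt {e : ℕ} (hE : HasRank R E e) {n : ℕ} (a : Fin n → E)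
    (hU : IsReduction (Submodule.span R (Set.range a))) :
    LinearIndependent (IsLocalRing.ResidueField (NagataExt R (Idx n e)))
      (fun j => (1 : IsLocalRing.ResidueField (NagataExt R (Idx n e))) ⊗ₜ[NagataExt R (Idx n e)]
        genElt (R := R) e a j) := by
  let k := IsLocalRing.ResidueField R
  let N := NagataExt R (Idx n e)
  let K := IsLocalRing.ResidueField N
  obtain ⟨s, hs⟩ := exists_linearIndependent_residue hE a hU
  let b := Module.finBasis k (k ⊗[R] E)
  let f₀ := fun l => (b.coord l).restrictScalars R ∘ₗ TensorProduct.mk R k E 1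
  let f : Fin (Module.finrank k (k ⊗[R] E)) → E →ₗ[R] K := fun l =>
    (IsScalarTower.toAlgHom R k K).toLinearMap ∘ₗ f₀ l
  rw [Fintype.linearIndependent_iff]
  intro r hr
  choose r' hr' using fun j => IsLocalRing.residue_surjective (r j)
  obtain ⟨q, hq, p, hp⟩ := exists_nagata_denominator r'
  choose w hw using fun i l => IsLocalRing.residue_surjective (f₀ l (a i))
  have hmem : ∀ l, ∑ j, ∑ i, p j * MvPolynomial.X (i, j) * MvPolynomial.C (w i l) ∈
      extMax R (Idx n e) := by
    intro l
    have h0 := congrArg (((f l).liftBaseChange N).liftBaseChange K)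
      (congrArg (IsLocalRing.residue N (algebraMap _ N q) • ·) hr)
    rw [smul_zero, map_zero, Finset.smul_sum, map_sum] at h0
    have hl : ∀ j, ((f l).liftBaseChange N).liftBaseChange K
        (IsLocalRing.residue N (algebraMap _ N q) • r j • (1 : K) ⊗ₜ[N] genElt e a j) =
        IsLocalRing.residue N (algebraMap _ N q) * (r j *
          ∑ i, IsLocalRing.residue N (nagataVar R (Idx n e) (i, j)) *
            algebraMap k K (f₀ l (a i))) := fun j => by
      rw [map_smul, map_smul]
      exact congrArg (fun y => IsLocalRing.residue N (algebraMap _ N q) * (r j * y))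
        (liftBaseChange_residue_genElt a (f₀ l) j)
    rw [Finset.sum_congr rfl fun j _ => hl j] at h0
    rw [← algebraMap_mem_maximalIdeal_nagata, ← IsLocalRing.residue_eq_zero_iff, ← h0, map_sum,
      map_sum]
    refine Finset.sum_congr rfl fun j _ => ?_
    rw [map_sum, map_sum, Finset.mul_sum, Finset.mul_sum]
    refine Finset.sum_congr rfl fun i _ => ?_
    simp only [map_mul, ← hp, hr', mul_assoc]
    congr 3
    rw [← hw, ← algebraMap_nagata_apply]
    rfl
  have hz := eq_zero_of_generic_relation (fun i l => f₀ l (a i))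
    (fun (j : Fin (e - 1)) => Pi.single (s (Fin.castLE (Nat.sub_le e 1) j)) (1 : k))
    (by
      have h1 := ((hs.comp _ (Fin.castLE_injective (Nat.sub_le e 1))).map' b.equivFun.toLinearMap
        b.equivFun.ker)
      have h2 : (fun j l => ∑ i, (Pi.single (s (Fin.castLE (Nat.sub_le e 1) j)) (1 : k) :
          Fin n → k) i * f₀ l (a i)) = ⇑b.equivFun.toLinearMap ∘
          (fun j => (1 : k) ⊗ₜ[R] a (s j)) ∘ Fin.castLE (Nat.sub_le e 1) := by
        funext j l
        simp [Pi.single_apply, f₀]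
      rw [h2]
      exact h1)
    (fun j => MvPolynomial.map (IsLocalRing.residue R) (p j))
    (fun l => by
      have := mem_extMax_iff_map_residue.1 (hmem l)
      simpa only [map_sum, map_mul, MvPolynomial.map_X, MvPolynomial.map_C, hw] using this)
  intro j
  have h1 := (IsLocalRing.residue_eq_zero_iff _).2 (algebraMap_mem_maximalIdeal_nagata.2
    (mem_extMax_iff_map_residue.2 (hz j)))
  rw [← hp, map_mul, hr'] at h1
  exact (mul_eq_zero.1 h1).resolve_left fun h => hq
    (algebraMap_mem_maximalIdeal_nagata.1 ((IsLocalRing.residue_eq_zero_iff _).1 h))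

end ResidueIndependence

/-! ### Minimal numbers of generators and quotients by part of a minimal generating system. -/

section Generators

theorem mu_eq_finrank (A : Type*) [CommRing A] [IsLocalRing A] (M : Type*) [AddCommGroup M]
    [Module A M] [Module.Finite A M] :
    mu A M = Module.finrank (IsLocalRing.ResidueField A) (IsLocalRing.ResidueField A ⊗[A] M) := by
  rw [mu, ← TensorProduct.spanFinrank_top_eq_of_residueField _ Module.Finite.fg_top,
    ← Module.finrank_eq_spanFinrank_of_free]
  exact (Submodule.topEquiv.baseChange A (IsLocalRing.ResidueField A) _ _).finrank_eq

theorem baseChange_linearCombination (A : Type*) [CommRing A] (K : Type*) [CommRing K] [Algebra A K]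
    {M : Type*} [AddCommGroup M] [Module A M] {J : Type*} [Fintype J] [DecidableEq J] (x : J → M) :
    (Fintype.linearCombination A x).baseChange K =
      Fintype.linearCombination K (fun j => (1 : K) ⊗ₜ[A] x j) ∘ₗ
        (TensorProduct.piScalarRight A K K J).toLinearMap := by
  ext j
  simp [Fintype.linearCombination_apply, Pi.single_apply]

/-- Dividing by elements that are linearly independent modulo the maximal ideal. -/
theorem mu_quotient_span_add_card (A : Type*) [CommRing A] [IsLocalRing A] {M : Type*}
    [AddCommGroup M] [Module A M] [Module.Finite A M] {J : Type*} [Fintype J] (x : J → M)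
    (hx : LinearIndependent (IsLocalRing.ResidueField A)
      (fun j => (1 : IsLocalRing.ResidueField A) ⊗ₜ[A] x j)) :
    mu A (M ⧸ Submodule.span A (Set.range x)) + Fintype.card J = mu A M := by
  let K := IsLocalRing.ResidueField A
  rw [mu_eq_finrank, mu_eq_finrank, ← finrank_span_eq_card hx]
  let g := (Submodule.span A (Set.range x)).mkQ.baseChange K
  have hg : Function.Surjective g := LinearMap.lTensor_surjective K (Submodule.mkQ_surjective _)
  have hker : LinearMap.ker g = Submodule.span K (Set.range fun j => (1 : K) ⊗ₜ[A] x j) := by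
    classical
    have h1 := lTensor_exact K (f := Fintype.linearCombination A x)
      (g := (Submodule.span A (Set.range x)).mkQ)
      (by rw [LinearMap.exact_iff, Submodule.ker_mkQ, Fintype.range_linearCombination])
      (Submodule.mkQ_surjective _)
    have h2 : LinearMap.ker g = LinearMap.range ((Fintype.linearCombination A x).baseChange K) :=
      SetLike.ext fun y => h1 y
    rw [h2, baseChange_linearCombination, LinearMap.range_comp, LinearEquiv.range,
      ← LinearMap.range_eq_map, Fintype.range_linearCombination]
  rw [← hker, ← (LinearMap.finrank_range_add_finrank_ker g), LinearMap.range_eq_top.2 hg,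
    finrank_top]

theorem free_quotient_span (A : Type*) [CommRing A] [IsLocalRing A] {M : Type*}
    [AddCommGroup M] [Module A M] [Module.Finite A M] [Module.Free A M]
    {J : Type*} [Fintype J] (x : J → M)
    (hx : LinearIndependent (IsLocalRing.ResidueField A)
      (fun j => (1 : IsLocalRing.ResidueField A) ⊗ₜ[A] x j)) :
    Module.Free A (M ⧸ Submodule.span A (Set.range x)) := by
  classical
  let K := IsLocalRing.ResidueField A
  let f := Fintype.linearCombination A x
  refine Module.free_of_lTensor_residueField_injective f (Submodule.span A (Set.range x)).mkQ
    (Submodule.mkQ_surjective _) ?_ ?_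
  · rw [LinearMap.exact_iff, Submodule.ker_mkQ, Fintype.range_linearCombination]
  · have h2 : Function.Injective (f.baseChange K) := by
      rw [baseChange_linearCombination]
      exact (linearIndependent_iff_injective_fintypeLinearCombination.1 hx).comp (LinearEquiv.injective _)
    exact h2

end Generators

/-! ### Projective dimension under faithfully flat base change and quotients. -/

section Homological

open CategoryTheory

variable {A : Type u} [CommRing A]

/-- Injectivity of M ⊗ f can be tested after tensoring with `B`, where the map becomes (B ⊗ M) ⊗ f,
and B ⊗ M is flat over `A`. -/
theorem flat_of_faithfullyFlat_baseChange (B : Type*) [CommRing B] [Algebra A B]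
    [Module.FaithfullyFlat A B] (M : Type*) [AddCommGroup M] [Module A M]
    [Module.Flat B (B ⊗[A] M)] : Module.Flat A M := by
  have : Module.Flat A (B ⊗[A] M) := Module.Flat.trans A B _
  rw [Module.Flat.iff_lTensor_preserves_injective_linearMap]
  intro X Y _ _ _ _ f hf
  rw [← Module.FaithfullyFlat.lTensor_injective_iff_injective A B]
  have h := Module.Flat.lTensor_preserves_injective_linearMap (M := B ⊗[A] M) f hf
  rw [LinearMap.lTensor_tensor] at h
  simpa using h

theorem free_iff_free_baseChange (B : Type*) [CommRing B] [Algebra A B] [IsLocalRing A]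
    [Module.FaithfullyFlat A B] (M : Type*) [AddCommGroup M] [Module A M] [Module.Finite A M] :
    Module.Free B (B ⊗[A] M) ↔ Module.Free A M := by
  refine ⟨fun _ => ?_, fun _ => inferInstance⟩
  have := flat_of_faithfullyFlat_baseChange (A := A) B M
  exact Module.free_of_flat_of_isLocalRing

theorem hasProjectiveDimensionLT_one_iff_free [IsLocalRing A] [IsNoetherianRing A] (M : Type u)
    [AddCommGroup M] [Module A M] [Module.Finite A M] :
    HasProjectiveDimensionLT (ModuleCat.of A M) 1 ↔ Module.Free A M := by
  rw [← projective_iff_hasProjectiveDimensionLT_one, ← IsProjective.iff_projective]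
  exact ⟨fun _ => Module.free_of_flat_of_isLocalRing, fun _ => inferInstance⟩

/-- Projective dimension is invariant under a faithfully flat extension of local rings. -/
theorem hasProjectiveDimensionLT_baseChange_iff [IsLocalRing A] [IsNoetherianRing A]
    (B : Type u) [CommRing B] [IsLocalRing B] [IsNoetherianRing B] [Algebra A B]
    [Module.FaithfullyFlat A B] (n : ℕ) (M : Type u)
    [AddCommGroup M] [Module A M] [Module.Finite A M] :
    HasProjectiveDimensionLT (ModuleCat.of B (B ⊗[A] M)) (n + 1) ↔
      HasProjectiveDimensionLT (ModuleCat.of A M) (n + 1) := by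
  induction n generalizing M with
  | zero =>
    rw [zero_add, hasProjectiveDimensionLT_one_iff_free, hasProjectiveDimensionLT_one_iff_free,
      free_iff_free_baseChange]
  | succ n ih =>
    obtain ⟨m, f, hf⟩ := Module.Finite.exists_fin' A M
    -- Both sides drop by one on passing to this syzygy and its base change; `ULift` keeps the free
    -- cover in universe `u`.
    let f' : (ULift.{u} (Fin m) → A) →ₗ[A] M :=
      f ∘ₗ LinearMap.funLeft A A (ULift.up : Fin m → ULift.{u} (Fin m))
    have hf' : Function.Surjective f' :=
      hf.comp (LinearMap.funLeft_surjective_of_injective _ _ _ ULift.up_injective)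
    have h1 := LinearMap.shortExact_shortComplexKer hf'
    have h2 := ModuleCat.shortComplex_shortExact (ModuleCat.shortComplexOfCompEqZero
      ((LinearMap.ker f').subtype.baseChange B) (f'.baseChange B) (by
        rw [← LinearMap.baseChange_comp, LinearMap.comp_ker_subtype, LinearMap.baseChange_zero]))
      (Module.Flat.lTensor_exact B (LinearMap.exact_subtype_ker_map f'))
      (Module.Flat.lTensor_preserves_injective_linearMap _ (LinearMap.ker f').injective_subtype)
      (LinearMap.lTensor_surjective B hf')
    have p1 : Projective (ModuleCat.of A (ULift.{u} (Fin m) → A)) :=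
      (IsProjective.iff_projective _).1 inferInstance
    have p2 : Projective (ModuleCat.of B (B ⊗[A] (ULift.{u} (Fin m) → A))) :=
      (IsProjective.iff_projective _).1 inferInstance
    exact (h2.hasProjectiveDimensionLT_X₃_iff n p2).trans
      ((ih (LinearMap.ker f')).trans (h1.hasProjectiveDimensionLT_X₃_iff n p1).symm)

theorem shortExact_span_range {M : Type u} [AddCommGroup M] [Module A M] {J : Type}
    (x : J → M) :
    (ModuleCat.shortComplexOfCompEqZero (Submodule.span A (Set.range x)).subtype
      (Submodule.span A (Set.range x)).mkQ
      (LinearMap.ext fun y => (Submodule.Quotient.mk_eq_zero _).2 y.2)).ShortExact :=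
  ModuleCat.shortComplex_shortExact _ (LinearMap.exact_subtype_mkQ _)
    (Submodule.injective_subtype _) (Submodule.mkQ_surjective _)

/-- Dividing by a free submodule whose basis stays independent modulo the maximal ideal does not
change the projective dimension. -/
theorem hasProjectiveDimensionLT_quotient_span_iff [IsLocalRing A] [IsNoetherianRing A]
    {M : Type u} [AddCommGroup M] [Module A M] [Module.Finite A M] {J : Type} [Fintype J]
    (x : J → M) (hx : LinearIndependent A x)
    (hx' : LinearIndependent (IsLocalRing.ResidueField A)
      (fun j => (1 : IsLocalRing.ResidueField A) ⊗ₜ[A] x j)) (n : ℕ) :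
    HasProjectiveDimensionLT (ModuleCat.of A (M ⧸ Submodule.span A (Set.range x))) (n + 1) ↔
      HasProjectiveDimensionLT (ModuleCat.of A M) (n + 1) := by
  have hS := shortExact_span_range (A := A) x
  have : Module.Free A (Submodule.span A (Set.range x)) := .of_basis (Module.Basis.span hx)
  have h1 : HasProjectiveDimensionLT (ModuleCat.of A (Submodule.span A (Set.range x))) 1 :=
    (hasProjectiveDimensionLT_one_iff_free _).2 this
  refine ⟨fun h => hS.hasProjectiveDimensionLT_X₂ _
    (hasProjectiveDimensionLT_of_ge _ 1 _ (Nat.le_add_left 1 n)) h, fun h => ?_⟩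
  -- The long exact sequence only bounds the quotient's projective dimension by one when `M` is
  -- free. Independence modulo the maximal ideal is needed precisely there.
  cases n with
  | zero =>
    rw [zero_add, hasProjectiveDimensionLT_one_iff_free] at h ⊢
    exact free_quotient_span A x hx'
  | succ n =>
    exact hS.hasProjectiveDimensionLT_X₃ (n + 1)
      (hasProjectiveDimensionLT_of_ge _ 1 _ (Nat.le_add_left 1 n)) h

end Homological

/-! ### Generators, freeness and projective dimension of E''/F. -/

section Construction

open CategoryTheory

variable {R : Type u} [CommRing R] [IsLocalRing R]
  {E : Type u} [AddCommGroup E] [Module R E] [Module.Finite R E] {e n : ℕ} (a : Fin n → E)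

theorem mu_baseChange (A : Type*) [CommRing A] [IsLocalRing A] (B : Type*) [CommRing B]
    [IsLocalRing B] [Algebra A B] [IsLocalHom (algebraMap A B)] (M : Type*) [AddCommGroup M]
    [Module A M] [Module.Finite A M] : mu B (B ⊗[A] M) = mu A M := by
  rw [mu_eq_finrank, mu_eq_finrank, ← Module.finrank_baseChange
    (R := IsLocalRing.ResidueField B) (S := IsLocalRing.ResidueField A)]
  exact ((TensorProduct.AlgebraTensorModule.cancelBaseChange A B (IsLocalRing.ResidueField B)
    (IsLocalRing.ResidueField B) M).trans
    (TensorProduct.AlgebraTensorModule.cancelBaseChange A (IsLocalRing.ResidueField A)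
      (IsLocalRing.ResidueField B) (IsLocalRing.ResidueField B) M).symm).finrank_eq

theorem mu_eBar_add (hE : HasRank R E e) (hU : IsReduction (Submodule.span R (Set.range a))) :
    mu (NagataExt R (Idx n e)) (EBar (R := R) e a) + (e - 1) = mu R E := by
  have h := mu_quotient_span_add_card _ _ (linearIndependent_residue_genElt hE a hU)
  rw [mu_baseChange, Fintype.card_fin] at h
  exact h

theorem le_mu_of_isReduction (hE : HasRank R E e)
    (hU : IsReduction (Submodule.span R (Set.range a))) : e ≤ mu R E := by
  obtain ⟨s, hs⟩ := exists_linearIndependent_residue hE a hU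
  rw [mu_eq_finrank]
  simpa using hs.fintype_card_le_finrank

variable [IsNoetherianRing R]

theorem hasProjectiveDimensionLT_eBar_iff (hE : HasRank R E e)
    (hU : IsReduction (Submodule.span R (Set.range a))) (m : ℕ) :
    HasProjectiveDimensionLT (ModuleCat.of (NagataExt R (Idx n e)) (EBar (R := R) e a)) (m + 1) ↔
      HasProjectiveDimensionLT (ModuleCat.of R E) (m + 1) :=
  (hasProjectiveDimensionLT_quotient_span_iff _ (linearIndependent_genElt e a hE hU)
    (linearIndependent_residue_genElt hE a hU) m).trans
    (hasProjectiveDimensionLT_baseChange_iff _ m E)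

theorem free_eBar_iff (hE : HasRank R E e)
    (hU : IsReduction (Submodule.span R (Set.range a))) :
    Module.Free (NagataExt R (Idx n e)) (EBar (R := R) e a) ↔ Module.Free R E := by
  rw [← hasProjectiveDimensionLT_one_iff_free, ← hasProjectiveDimensionLT_one_iff_free]
  exact hasProjectiveDimensionLT_eBar_iff a hE hU 0

theorem mu_eq_zero_of_subsingleton (A : Type*) [CommRing A] (M : Type*) [AddCommGroup M]
    [Module A M] [Subsingleton M] : mu A M = 0 := by
  rw [mu, Subsingleton.elim (⊤ : Submodule A M) ⊥, Submodule.spanFinrank_bot]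

theorem projDim_eBar (he : 1 ≤ e) (hE : HasRank R E e)
    (hU : IsReduction (Submodule.span R (Set.range a))) :
    projDim (NagataExt R (Idx n e)) (EBar (R := R) e a) = projDim R E := by
  have h1 := le_mu_of_isReduction a hE hU
  have h2 := mu_eBar_add a hE hU
  have key : ∀ m : ℕ, projDim (NagataExt R (Idx n e)) (EBar (R := R) e a) < m ↔
      projDim R E < m := by
    intro m
    rw [projDim, projDim, projectiveDimension_lt_iff, projectiveDimension_lt_iff]
    -- Projective dimension below 0 means the zero module. Neither module vanishes: μ(E) ≥ e, while
    -- μ(E''/F) = μ(E) - (e - 1).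
    cases m with
    | zero =>
      rw [hasProjectiveDimensionLT_zero_iff_isZero, hasProjectiveDimensionLT_zero_iff_isZero,
        ModuleCat.isZero_iff_subsingleton, ModuleCat.isZero_iff_subsingleton]
      constructor
      · intro (h : Subsingleton (EBar (R := R) e a))
        have := mu_eq_zero_of_subsingleton (NagataExt R (Idx n e)) (EBar (R := R) e a)
        omega
      · intro (h : Subsingleton E)
        have := mu_eq_zero_of_subsingleton R E
        omega
    | succ m => exact hasProjectiveDimensionLT_eBar_iff a hE hU m
  have aux : ∀ x y : WithBot ℕ∞, (∀ m : ℕ, x < m → y < m) → y ≤ x := by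
    intro x y h
    induction x with
    | bot =>
      have h0 := h 0 (by simp)
      rw [Nat.cast_zero, WithBot.lt_zero_iff_eq_bot] at h0
      exact h0.le
    | coe x =>
      induction x with
      | top => exact le_top
      | coe x =>
        have h1 := h (x + 1) (by
          rw [Nat.cast_add, Nat.cast_one, ENat.WithBot.lt_add_one_iff]; rfl)
        rwa [Nat.cast_add, Nat.cast_one, ENat.WithBot.lt_add_one_iff] at h1
  exact le_antisymm (aux _ _ fun m => (key m).2) (aux _ _ fun m => (key m).1)

end Construction

/-! ### Reductions under base change. -/

section BaseChangeReduction

variable {A B : Type*} [CommRing A] [CommRing B] [Algebra A B] {M M' : Type*} [AddCommGroup M]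
  [Module A M] [AddCommGroup M'] [Module A M'] [Module B M'] [IsScalarTower A B M']

/-- Preservation of regular elements gives a ring map R(M) → R(M'). Its images of the graded pieces
span those of R(M') over `B`, so the equation defining a reduction carries over. -/
theorem isReduction_of_map (h : ∀ s ∈ nonZeroDivisors A, algebraMap A B s ∈ nonZeroDivisors B)
    (φ : M →ₗ[A] M') (hφ : Submodule.span B (Set.range φ) = ⊤) {V : Submodule A M}
    (hV : IsReduction V) {V' : Submodule B M'} (hV' : ∀ v ∈ V, φ v ∈ V') : IsReduction V' := by
  let i1 : Algebra A (ReesAlg B M') :=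
    ((algebraMap B (ReesAlg B M')).comp (algebraMap A B)).toAlgebra
  have : IsScalarTower A B (ReesAlg B M') := IsScalarTower.of_algebraMap_eq fun _ => rfl
  let Φ : ReesAlg A M →ₐ[A] ReesAlg B M' :=
    reesLift (fun s hs => algebraMap_reesAlg_mem_nonZeroDivisors _ (h s hs))
      ((reesMap B M').restrictScalars A ∘ₗ φ)
  have hΦ : ∀ x, Φ (reesMap A M x) = reesMap B M' (φ x) := fun x => reesLift_map _ _ x
  have hmem : ∀ m, ∀ y ∈ reesPiece A M m, Φ y ∈ reesPiece B M' m := by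
    intro m
    induction m with
    | zero =>
      intro y hy
      rw [reesPiece, pow_zero] at hy
      obtain ⟨r, rfl⟩ := Submodule.mem_one.1 hy
      rw [AlgHom.commutes, reesPiece, pow_zero, IsScalarTower.algebraMap_apply A B]
      exact Submodule.algebraMap_mem _
    | succ m ih =>
      intro y hy
      rw [reesPiece, pow_succ] at hy
      rw [reesPiece, pow_succ]
      induction hy using Submodule.mul_induction_on' with
      | mem_mul_mem y hy z hz =>
        obtain ⟨x, rfl⟩ := hz
        rw [map_mul, hΦ]
        exact Submodule.mul_mem_mul (ih y hy) (LinearMap.mem_range_self _ _)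
      | add y _ z _ hy hz => rw [map_add]; exact add_mem hy hz
  have hspan : ∀ m, reesPiece B M' m ≤ Submodule.span B (Φ '' (reesPiece A M m : Set _)) := by
    intro m
    induction m with
    | zero =>
      rw [reesPiece, pow_zero, Submodule.one_le]
      refine Submodule.subset_span ⟨1, ?_, map_one Φ⟩
      rw [reesPiece, pow_zero]
      exact Submodule.one_le.1 le_rfl
    | succ m ih =>
      have h1 : LinearMap.range (reesMap B M') ≤
          Submodule.span B (Φ '' (LinearMap.range (reesMap A M) : Set _)) := by
        rw [LinearMap.range_eq_map, ← hφ, Submodule.map_span]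
        refine Submodule.span_mono ?_
        rintro _ ⟨_, ⟨x, rfl⟩, rfl⟩
        exact ⟨_, LinearMap.mem_range_self _ x, hΦ x⟩
      rw [reesPiece, pow_succ]
      refine (mul_le_mul' ih h1).trans ?_
      rw [Submodule.span_mul_span]
      refine Submodule.span_mono ?_
      rintro _ ⟨_, ⟨y, hy, rfl⟩, _, ⟨z, hz, rfl⟩, rfl⟩
      refine ⟨y * z, ?_, map_mul Φ y z⟩
      rw [reesPiece, pow_succ]
      exact Submodule.mul_mem_mul hy hz
  obtain ⟨r, hr⟩ := hV
  refine ⟨r, le_antisymm ((hspan (r + 1)).trans (Submodule.span_le.2 ?_))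
    (map_mul_reesPiece_le V' r)⟩
  rintro _ ⟨y, hy, rfl⟩
  rw [SetLike.mem_coe, hr] at hy
  rw [SetLike.mem_coe]
  induction hy using Submodule.mul_induction_on' with
  | mem_mul_mem y hy z hz =>
    obtain ⟨v, hv, rfl⟩ := hy
    rw [map_mul, hΦ]
    exact Submodule.mul_mem_mul (Submodule.mem_map_of_mem (hV' v hv)) (hmem r z hz)
  | add y _ z _ hy hz => rw [map_add]; exact add_mem hy hz

end BaseChangeReduction

section

variable {R : Type u} [CommRing R] [IsLocalRing R] {E : Type u} [AddCommGroup E] [Module R E]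
  {e n : ℕ} (a : Fin n → E)

theorem isReduction_uBar (hU : IsReduction (Submodule.span R (Set.range a))) :
    IsReduction (UBar (R := R) e a) := by
  refine isReduction_of_map (A := R) (B := NagataExt R (Idx n e))
    algebraMap_nagata_mem_nonZeroDivisors
    (((genF (R := R) e a).mkQ.restrictScalars R) ∘ₗ TensorProduct.mk R (NagataExt R (Idx n e)) E 1)
    ?_ hU (fun v hv => Submodule.mem_map_of_mem (Submodule.tmul_mem_baseChange_of_mem 1 hv))
  rw [LinearMap.coe_comp, Set.range_comp]
  change Submodule.span _ ((genF (R := R) e a).mkQ '' _) = ⊤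
  have h1 : Submodule.span (NagataExt R (Idx n e))
      (Set.range (TensorProduct.mk R (NagataExt R (Idx n e)) E 1)) = ⊤ := by
    refine eq_top_iff.2 fun t _ => ?_
    induction t using TensorProduct.induction_on with
    | zero => exact zero_mem _
    | add s t hs ht => exact add_mem (hs trivial) (ht trivial)
    | tmul q x =>
      rw [show q ⊗ₜ[R] x = q • ((1 : NagataExt R (Idx n e)) ⊗ₜ[R] x) by
        simp [TensorProduct.smul_tmul']]
      exact Submodule.smul_mem _ _ (Submodule.subset_span ⟨x, rfl⟩)
  rw [← Submodule.map_span, h1, Submodule.map_top, Submodule.range_mkQ]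

end

/-! ### The Rees algebra inside a polynomial ring over the total ring of fractions. -/

section Embedding

variable {R : Type*} [CommRing R] {E : Type*} [AddCommGroup E] [Module R E] {e : ℕ}
  (h : (FractionRing R ⊗[R] E) ≃ₗ[FractionRing R] (Fin e → FractionRing R))

theorem algebraMap_mvPolynomial_mem_nonZeroDivisors (s : R) (hs : s ∈ nonZeroDivisors R) :
    algebraMap R (MvPolynomial (Fin e) (FractionRing R)) s ∈ nonZeroDivisors _ := by
  rw [IsScalarTower.algebraMap_apply R (FractionRing R)]
  exact ((IsLocalization.map_units (FractionRing R) ⟨s, hs⟩).map _).mem_nonZeroDivisors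

/-- The embedding of the Rees algebra of a module of rank `e` into the polynomial ring over the
total ring of fractions. -/
noncomputable def reesEmb : ReesAlg R E →ₐ[R] MvPolynomial (Fin e) (FractionRing R) :=
  reesLift algebraMap_mvPolynomial_mem_nonZeroDivisors
    (((Fintype.linearCombination (FractionRing R)
      (MvPolynomial.X : Fin e → MvPolynomial (Fin e) (FractionRing R))).restrictScalars R) ∘ₗ
        rankCoord h)

theorem reesEmb_map (x : E) :
    reesEmb h (reesMap R E x) = ∑ l, MvPolynomial.C (rankCoord h x l) * MvPolynomial.X l := by
  rw [reesEmb, reesLift_map]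
  simp [Fintype.linearCombination_apply, MvPolynomial.smul_eq_C_mul]

/-- Sending the variables to the basis of Q ⊗ E turns the embedding into t ↦ 1 ⊗ t on the symmetric
algebra. This is localization at the regular elements, so its kernel is the torsion. -/
theorem reesEmb_injective : Function.Injective (reesEmb h) := by
  classical
  rw [injective_iff_map_eq_zero]
  intro y hy
  obtain ⟨t, rfl⟩ := reesMk_surjective y
  let g : MvPolynomial (Fin e) (FractionRing R) →ₐ[FractionRing R]
      FractionRing R ⊗[R] SymmetricAlgebra R E :=
    MvPolynomial.aeval fun l =>
      (SymmetricAlgebra.ι R E).baseChange (FractionRing R) (h.symm (Pi.single l 1))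
  have hg : (g.restrictScalars R).comp ((reesEmb h).comp (reesMk R E)) =
      Algebra.TensorProduct.includeRight := by
    refine SymmetricAlgebra.algHom_ext (LinearMap.ext fun x => ?_)
    change g (reesEmb h (reesMap R E x)) = 1 ⊗ₜ SymmetricAlgebra.ι R E x
    have h1 : h.symm (rankCoord h x) = 1 ⊗ₜ x := by
      rw [rankCoord_apply, LinearEquiv.symm_apply_apply]
    have h2 := congrArg h.symm (pi_eq_sum_univ' (rankCoord h x))
    rw [h1] at h2
    rw [← LinearMap.baseChange_tmul, h2, reesEmb_map]
    rw [map_sum, map_sum, map_sum]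
    refine Finset.sum_congr rfl fun l _ => ?_
    rw [map_mul, map_smul, map_smul, MvPolynomial.aeval_X, ← MvPolynomial.algebraMap_eq,
      AlgHom.commutes, ← Algebra.smul_def]
  have h3 := congrArg (fun f => f t) hg
  simp only [AlgHom.comp_apply, hy, map_zero] at h3
  have h4 : TensorProduct.mk R (FractionRing R) (SymmetricAlgebra R E) 1 t = 0 := h3.symm
  have := isLocalizedModule_iff_isBaseChange (nonZeroDivisors R) (FractionRing R)
    (TensorProduct.mk R (FractionRing R) (SymmetricAlgebra R E) 1) |>.2
      (TensorProduct.isBaseChange R (SymmetricAlgebra R E) (FractionRing R))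
  obtain ⟨s, hs⟩ := (IsLocalizedModule.eq_zero_iff (nonZeroDivisors R) _).1 h4
  exact (reesMk_eq_zero_iff t).2 ⟨s, s.2, hs⟩

end Embedding

/-! ### Minimal primes of the base ring and components of the Rees algebra. -/

section Components

variable {R : Type u} [CommRing R] [IsNoetherianRing R]
  {E : Type u} [AddCommGroup E] [Module R E] {e : ℕ}
  (h : (FractionRing R ⊗[R] E) ≃ₗ[FractionRing R] (Fin e → FractionRing R))

/-- A prime ideal of the Rees algebra of a module of rank `e` contains the kernel of the map to a
polynomial ring in `e` variables over the residue field of a minimal prime of the base ring. -/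
theorem exists_residue_ker_le (P : Ideal (ReesAlg R E)) [P.IsPrime] :
    ∃ (κ : Type u) (_ : Field κ) (ν : FractionRing R →+* κ) (c : R), c ≠ 0 ∧
      (∀ r, ν (algebraMap R _ r) = 0 → r * c = 0) ∧
      RingHom.ker ((MvPolynomial.map ν).comp (reesEmb h).toRingHom) ≤ P := by
  classical
  have : Finite (minimalPrimes R) := minimalPrimes.finite_of_isNoetherianRing R
  have := Fintype.ofFinite (minimalPrimes R)
  have hprime : ∀ q : minimalPrimes R, q.1.IsPrime := fun q => q.2.1.1
  let ρ : ∀ q : minimalPrimes R, R →+* FractionRing (R ⧸ q.1) := fun q =>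
    (algebraMap (R ⧸ q.1) _).comp (Ideal.Quotient.mk q.1)
  have hρ : ∀ q r, ρ q r = 0 ↔ r ∈ q.1 := fun q r => by
    rw [← Ideal.Quotient.eq_zero_iff_mem]
    exact map_eq_zero_iff _ (IsFractionRing.injective (R ⧸ q.1) _)
  have hreg : ∀ q, ∀ s : nonZeroDivisors R, IsUnit (ρ q s) := fun q s => by
    refine isUnit_iff_ne_zero.2 fun h0 => ?_
    exact Set.disjoint_left.1 (Ideal.disjoint_nonZeroDivisors_of_mem_minimalPrimes q.2)
      ((hρ q s).1 h0) s.2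
  let ν : ∀ q : minimalPrimes R, FractionRing R →+* FractionRing (R ⧸ q.1) := fun q => IsLocalization.lift (hreg q)
  have hν : ∀ q r, ν q (algebraMap R _ r) = ρ q r := fun q r => IsLocalization.lift_eq (hreg q) r
  -- The intersection of the kernels over all minimal primes is nil, so it lies in `P`; being a
  -- finite intersection, one of its members does too.
  have hinf : Finset.univ.inf (fun q => RingHom.ker ((MvPolynomial.map (ν q)).comp
      (reesEmb h).toRingHom)) ≤ P := by
    intro y hy
    have hy' : ∀ q, MvPolynomial.map (ν q) (reesEmb h y) = 0 := fun q =>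
      (Finset.inf_le (f := fun q => RingHom.ker ((MvPolynomial.map (ν q)).comp
        (reesEmb h).toRingHom)) (Finset.mem_univ q)) hy
    have hnil : IsNilpotent (reesEmb h y) := by
      rw [MvPolynomial.isNilpotent_iff]
      intro m
      obtain ⟨⟨b, s⟩, hb⟩ := IsLocalization.surj (nonZeroDivisors R)
        (MvPolynomial.coeff m (reesEmb h y))
      have hb' : b ∈ nilradical R := by
        rw [nilradical, ← Ideal.sInf_minimalPrimes, Ideal.mem_sInf]
        intro q hq
        have h1 := congrArg (MvPolynomial.coeff m) (hy' ⟨q, hq⟩)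
        rw [MvPolynomial.coeff_map, MvPolynomial.coeff_zero] at h1
        have h2 := congrArg (ν ⟨q, hq⟩) hb
        rw [map_mul, h1, zero_mul, hν] at h2
        exact (hρ ⟨q, hq⟩ b).1 h2.symm
      have h3 : IsNilpotent (MvPolynomial.coeff m (reesEmb h y) * algebraMap R _ s.1) := by
        rw [hb]
        exact IsNilpotent.map hb' (algebraMap R (FractionRing R))
      obtain ⟨t, ht⟩ := h3
      rw [mul_pow] at ht
      exact ⟨t, ((IsLocalization.map_units (FractionRing R) s).pow t).mul_left_eq_zero.1 ht⟩
    obtain ⟨t, ht⟩ := hnil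
    rw [← map_pow] at ht
    exact Ideal.IsPrime.mem_of_pow_mem ‹_› t
      ((reesEmb_injective h (ht.trans (map_zero _).symm)).symm ▸ zero_mem P)
  obtain ⟨q, -, hq⟩ := (Ideal.IsPrime.inf_le' ‹_›).1 hinf
  -- A minimal prime of a Noetherian ring is associated, hence the annihilator of an element.
  obtain ⟨c, hc⟩ : ∃ c : R, ∀ r, r ∈ q.1 ↔ r * c = 0 := by
    have hann : Module.annihilator R R = ⊥ := Module.annihilator_eq_bot.2 inferInstance
    have hass : q.1 ∈ associatedPrimes R R :=
      Module.associatedPrimes.minimalPrimes_annihilator_subset_associatedPrimes R R (by rw [hann]; exact q.2)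
    obtain ⟨-, c, hc⟩ := isAssociatedPrime_iff.1 hass
    refine ⟨c, fun r => ?_⟩
    rw [hc, Submodule.mem_colon_singleton, Submodule.mem_bot, smul_eq_mul]
  refine ⟨FractionRing (R ⧸ q.1), inferInstance, ν q, c, ?_, fun r hr => ?_, hq⟩
  · rintro rfl
    exact (hprime q).ne_top ((Ideal.eq_top_iff_one _).2 ((hc 1).2 (mul_zero 1)))
  · rw [hν] at hr
    exact (hc r).1 ((hρ q r).1 hr)

end Components

/-! ### A linear form cutting out the generic combinations. -/

section GenericFunctional

open MvPolynomial

/-- Over the field of rational functions in the generic coefficients there is a linear form that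
vanishes on `e - 1` generic combinations of vectors spanning an `e`-dimensional space, but not on
a given nonzero one of those vectors. -/
theorem exists_generic_linearForm {κ : Type*} [Field κ] {e n : ℕ} (v : Fin n → Fin e → κ)
    (hv : ∀ y : Fin e → κ, ∃ c : Fin n → κ, ∑ i, c i • v i = y) (i₀ : Fin n) (hi₀ : v i₀ ≠ 0) :
    ∃ t : Fin e → FractionRing (MvPolynomial (Idx n e) κ),
      (∀ j : Fin (e - 1), ∑ i, algebraMap (MvPolynomial (Idx n e) κ)
          (FractionRing (MvPolynomial (Idx n e) κ)) (X (i, j)) *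
        ∑ l, algebraMap κ _ (v i l) * t l = 0) ∧
      ∑ l, algebraMap κ _ (v i₀ l) * t l ≠ 0 := by
  classical
  let P := MvPolynomial (Idx n e) κ
  let L := FractionRing P
  let w : Fin n → Fin e → L := fun i l => algebraMap κ L (v i l)
  let x : Fin (e - 1) → Fin e → L := fun j => ∑ i, algebraMap P L (X (i, j)) • w i
  have hnot : w i₀ ∉ Submodule.span L (Set.range x) := by
    intro hmem
    obtain ⟨r, hr⟩ := (Submodule.mem_span_range_iff_exists_fun L).1 hmem
    obtain ⟨d, hd⟩ := IsLocalization.exist_integer_multiples_of_finite (nonZeroDivisors P) r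
    choose p hp using hd
    -- Modulo v_i₀ the dimension is e - 1 and the v_i still span, so the e - 1 generic combinations
    -- stay independent. Hence all r_j vanish, contradicting v_i₀ ≠ 0.
    let W := (Fin e → κ) ⧸ (κ ∙ v i₀)
    have hW : Module.finrank κ W = e - 1 := by
      have h1 := Submodule.finrank_quotient_add_finrank (κ ∙ v i₀)
      rw [finrank_span_singleton hi₀, Module.finrank_fin_fun] at h1
      exact Nat.eq_sub_of_add_eq h1
    let b := Module.finBasisOfFinrankEq κ W hW
    let lam : Fin (e - 1) → (Fin e → κ) →ₗ[κ] κ := fun l => b.coord l ∘ₗ (κ ∙ v i₀).mkQ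
    have hlam : ∀ l y, lam l y = ∑ m, y m * lam l (Pi.single m 1) := by
      intro l y
      conv_lhs => rw [pi_eq_sum_univ' y]
      simp
    have hchoice : ∀ j, ∃ c : Fin n → κ, (κ ∙ v i₀).mkQ (∑ i, c i • v i) = b j := by
      intro j
      obtain ⟨y, hy⟩ := (κ ∙ v i₀).mkQ_surjective (b j)
      obtain ⟨c, hc⟩ := hv y
      exact ⟨c, by rw [hc, hy]⟩
    choose c hc using hchoice
    have hzero := eq_zero_of_generic_relation (fun i l => lam l (v i)) c
      (by
        have h1 : (fun j l => ∑ i, c j i * lam l (v i)) = fun j => Pi.single j (1 : κ) := by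
          funext j l
          have h2 : ∑ i, c j i * lam l (v i) = lam l (∑ i, c j i • v i) := by simp
          rw [h2, LinearMap.comp_apply, hc]
          simp [Finsupp.single_apply, Pi.single_apply, eq_comm]
        rw [h1]
        exact Pi.linearIndependent_single_one (Fin (e - 1)) κ) p
      (by
        intro l
        refine IsFractionRing.injective P L ?_
        let Lam : (Fin e → L) →ₗ[L] L :=
          Fintype.linearCombination L fun m => algebraMap κ L (lam l (Pi.single m 1))
        have hLam : ∀ i, Lam (w i) = algebraMap P L (C (lam l (v i))) := fun i => by
          rw [hlam l (v i), map_sum, map_sum, Fintype.linearCombination_apply]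
          refine Finset.sum_congr rfl fun m _ => ?_
          rw [map_mul, map_mul, smul_eq_mul]
          rfl
        have h3 : lam l (v i₀) = 0 := by
          have : (κ ∙ v i₀).mkQ (v i₀) = 0 := by
            rw [Submodule.mkQ_apply, Submodule.Quotient.mk_eq_zero]
            exact Submodule.mem_span_singleton_self _
          rw [LinearMap.comp_apply, this, map_zero]
        have h1 := congrArg (fun y => algebraMap P L d * Lam y) hr
        beta_reduce at h1
        rw [hLam, h3, C_0, map_zero, mul_zero, map_sum, Finset.mul_sum] at h1
        rw [map_zero, ← h1, map_sum]
        refine Finset.sum_congr rfl fun j _ => ?_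
        rw [map_smul, smul_eq_mul, ← mul_assoc, ← Algebra.smul_def]
        have h4 : algebraMap P L (p j) = (d : P) • r j := hp j
        rw [← h4, map_sum, map_sum, Finset.mul_sum]
        refine Finset.sum_congr rfl fun i _ => ?_
        rw [map_smul, hLam, map_mul, map_mul, smul_eq_mul, mul_assoc])
    have hr0 : ∀ j, r j = 0 := by
      intro j
      have h1 := hp j
      rw [hzero j, map_zero, Algebra.smul_def] at h1
      exact (mul_eq_zero.1 h1.symm).resolve_left fun h2 =>
        nonZeroDivisors.ne_zero d.2 (IsFractionRing.injective P L (h2.trans (map_zero _).symm))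
    have hw : w i₀ = 0 := by simp [← hr, hr0]
    refine hi₀ (funext fun l => ?_)
    exact (algebraMap κ L).injective ((congrFun hw l).trans (map_zero _).symm)
  obtain ⟨f, hf, hfx⟩ := Submodule.exists_dual_map_eq_bot_of_notMem hnot inferInstance
  have hfw : ∀ i, f (w i) = ∑ l, algebraMap κ L (v i l) * f (Pi.single l 1) := by
    intro i
    conv_lhs => rw [pi_eq_sum_univ' (w i)]
    rw [map_sum]
    exact Finset.sum_congr rfl fun l _ => map_smul f _ _
  refine ⟨fun l => f (Pi.single l 1), fun j => ?_, by rw [← hfw]; exact hf⟩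
  have h1 : f (x j) = 0 := by
    have : f (x j) ∈ (Submodule.span L (Set.range x)).map f :=
      Submodule.mem_map_of_mem (Submodule.subset_span ⟨j, rfl⟩)
    rwa [hfx, Submodule.mem_bot] at this
  rw [← h1]
  simp only [x, map_sum, map_smul, smul_eq_mul, hfw]
  rfl

end GenericFunctional

/-! ### Solving the generic equations for one row of variables. -/

section Substitution

open MvPolynomial

variable {R D : Type*} [CommRing R] [CommRing D] (ρ : R →+* D) {ι J : Type*} [Fintype ι]
  [DecidableEq ι] (α : ι → D) (i₀ : ι)

/-- The substitution that makes the generic combinations of the `α i` vanish: up to the factor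
`α i₀`, it solves for the coefficients of `α i₀`. -/
noncomputable def solveSubst : MvPolynomial (ι × J) R →+* MvPolynomial (ι × J) D :=
  eval₂Hom (C.comp ρ) fun p => if p.1 = i₀ then
    -∑ i ∈ Finset.univ.erase i₀, X (i, p.2) * C (α i) else C (α i₀) * X p

theorem solveSubst_C (r : R) : solveSubst ρ α i₀ (C r : MvPolynomial (ι × J) R) = C (ρ r) := by
  simp [solveSubst]

theorem sum_solveSubst_X (j : J) :
    ∑ i, solveSubst ρ α i₀ (X (i, j)) * C (α i) = 0 := by
  rw [← Finset.add_sum_erase _ _ (Finset.mem_univ i₀)]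
  simp only [solveSubst, coe_eval₂Hom, eval₂_X, if_true]
  rw [neg_mul, Finset.sum_mul, neg_add_eq_zero]
  refine Finset.sum_congr rfl fun i hi => ?_
  rw [if_neg (Finset.ne_of_mem_erase hi)]
  ring

/-- At a point where the generic combinations already vanish, the substitution only rescales each
variable by α_i₀, so evaluating at z/α_i₀ undoes it. -/
theorem eval₂_solveSubst {F : Type*} [Field F] (χ : D →+* F) (z : ι × J → F)
    (h0 : χ (α i₀) ≠ 0) (hz : ∀ j, ∑ i, z (i, j) * χ (α i) = 0) (p : MvPolynomial (ι × J) R) :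
    eval₂ χ (fun p => z p / χ (α i₀)) (solveSubst ρ α i₀ p) = eval₂ (χ.comp ρ) z p := by
  have : (eval₂Hom χ (fun p => z p / χ (α i₀))).comp (solveSubst ρ α i₀) =
      eval₂Hom (χ.comp ρ) z := by
    refine MvPolynomial.ringHom_ext (fun r => ?_) fun p => ?_
    · simp [solveSubst_C]
    · obtain ⟨i, j⟩ := p
      simp only [RingHom.comp_apply, solveSubst, coe_eval₂Hom, eval₂_X]
      split_ifs with hi
      · subst hi
        have h1 := hz j
        rw [← Finset.add_sum_erase _ _ (Finset.mem_univ i)] at h1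
        rw [← coe_eval₂Hom, map_neg, map_sum]
        simp only [map_mul, coe_eval₂Hom, eval₂_X, eval₂_C, div_mul_eq_mul_div]
        rw [← Finset.sum_div, ← neg_div, div_eq_iff h0, neg_eq_iff_add_eq_zero, add_comm]
        exact h1
      · rw [← coe_eval₂Hom, map_mul, coe_eval₂Hom, eval₂_X, eval₂_C, mul_div_cancel₀ _ h0]
  exact RingHom.congr_fun this p

end Substitution

/-! ### Lifting points to the Rees algebra of E''/F. -/

section QuotientPoints

open MvPolynomial

variable {R : Type u} [CommRing R] {E : Type u} [AddCommGroup E] [Module R E]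
  {e n : ℕ} (a : Fin n → E)

/-- A point of the Rees algebra of a module of rank `e` factors through a domain quotient over
which the generic elements can be solved for without making a regular polynomial vanish. -/
theorem exists_domain_factorization [IsNoetherianRing R] [DecidableEq (Fin n)] (hE : HasRank R E e)
    (hU : IsReduction (Submodule.span R (Set.range a)))
    {Ω : Type*} [Field Ω] (ψ : ReesAlg R E →+* Ω) (i₀ : Fin n)
    (hi₀ : ψ (reesMap R E (a i₀)) ≠ 0) :
    ∃ (D : Type u) (_ : CommRing D) (_ : IsDomain D) (π : ReesAlg R E →+* D) (δ : D →+* Ω),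
      (∀ y, δ (π y) = ψ y) ∧ ∃ c : R, c ≠ 0 ∧ ∀ p : MvPolynomial (Idx n e) R,
        solveSubst (π.comp (algebraMap R _)) (fun i => π (reesMap R E (a i))) i₀ p = 0 →
        p * C c = 0 := by
  obtain ⟨h⟩ := hE
  have hP : (RingHom.ker ψ).IsPrime := RingHom.ker_isPrime ψ
  obtain ⟨κ, _, ν, c, hc0, hc, hker⟩ := exists_residue_ker_le h (RingHom.ker ψ)
  let β := (MvPolynomial.map ν).comp (reesEmb h).toRingHom
  have hβ : ∀ x, β (reesMap R E x) = ∑ l, C (ν (rankCoord h x l)) * X l := fun x => by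
    change MvPolynomial.map ν (reesEmb h (reesMap R E x)) = _
    rw [reesEmb_map]
    simp
  let v : Fin n → Fin e → κ := fun i l => ν (rankCoord h (a i) l)
  have hv : ∀ y : Fin e → κ, ∃ c : Fin n → κ, ∑ i, c i • v i = y := by
    intro y
    choose c hc using fun l => exists_coeff_rankCoord h hU (Pi.single l 1)
    refine ⟨fun i => ∑ l, y l * ν (c l i), funext fun m => ?_⟩
    have h1 : ∀ l, ∑ i, ν (c l i) * v i m = if m = l then 1 else 0 := fun l => by
      have := congrArg ν (hc l m)
      rw [map_sum] at this
      simp only [map_mul] at this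
      rw [this, Pi.single_apply]
      split_ifs <;> simp
    simp only [Finset.sum_apply, Pi.smul_apply, smul_eq_mul, Finset.sum_mul, mul_assoc]
    rw [Finset.sum_comm]
    simp only [← Finset.mul_sum, h1]
    simp
  have hv0 : v i₀ ≠ 0 := by
    intro h0
    refine hi₀ (hker (x := reesMap R E (a i₀)) ?_)
    change β (reesMap R E (a i₀)) = 0
    rw [hβ]
    refine Finset.sum_eq_zero fun l _ => ?_
    rw [show ν (rankCoord h (a i₀) l) = 0 from congrFun h0 l, C_0, zero_mul]
  obtain ⟨t, ht, ht0⟩ := exists_generic_linearForm v hv i₀ hv0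
  let D := ReesAlg R E ⧸ RingHom.ker β
  have hDp : (RingHom.ker β).IsPrime := RingHom.ker_isPrime β
  let π : ReesAlg R E →+* D := Ideal.Quotient.mk (RingHom.ker β)
  let L := FractionRing (MvPolynomial (Idx n e) κ)
  let χ : D →+* L := (eval₂Hom (algebraMap κ L) t).comp (RingHom.kerLift β)
  have hχ : ∀ x, χ (π (reesMap R E x)) = ∑ l, algebraMap κ L (ν (rankCoord h x l)) * t l := fun x => by
    change eval₂Hom (algebraMap κ L) t (RingHom.kerLift β (Ideal.Quotient.mk _ (reesMap R E x))) = _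
    rw [RingHom.kerLift_mk, hβ]
    simp
  refine ⟨D, inferInstance, inferInstance, π, Ideal.Quotient.lift (RingHom.ker β) ψ hker,
    fun y => rfl, c, hc0, fun p hp => ?_⟩
  -- Evaluating D at the generic linear form undoes the substitution, so if it kills `p`, then `p`
  -- vanishes over κ. Its coefficients are then annihilated by `c`.
  have h1 := eval₂_solveSubst (π.comp (algebraMap R (ReesAlg R E)))
    (fun i => π (reesMap R E (a i))) i₀ χ
    (fun p => algebraMap (MvPolynomial (Idx n e) κ) L (X p)) (by rw [hχ]; exact ht0)
    (fun j => by simp only [hχ]; exact ht j) p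
  have hχC : (χ.comp (π.comp (algebraMap R (ReesAlg R E)))) =
      ((algebraMap (MvPolynomial (Idx n e) κ) L).comp C).comp (ν.comp (algebraMap R _)) := by
    ext r
    change eval₂Hom (algebraMap κ L) t (RingHom.kerLift β (Ideal.Quotient.mk _ _)) = _
    rw [RingHom.kerLift_mk]
    change eval₂Hom (algebraMap κ L) t (MvPolynomial.map ν (reesEmb h (algebraMap R _ r))) = _
    rw [AlgHom.commutes, IsScalarTower.algebraMap_apply R (FractionRing R), algebraMap_eq, map_C,
      coe_eval₂Hom, eval₂_C]
    rfl
  have h2 : MvPolynomial.map (ν.comp (algebraMap R _)) p = 0 := by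
    refine IsFractionRing.injective (MvPolynomial (Idx n e) κ) L ?_
    rw [hp, eval₂_zero, hχC, ← eval₂_map] at h1
    rw [map_zero, h1, ← eval₂_eta (MvPolynomial.map (ν.comp (algebraMap R _)) p), hom_eval₂,
      eval₂_eta]
  ext m
  rw [mul_comm, coeff_C_mul, mul_comm, coeff_zero]
  refine hc _ ?_
  have := congrArg (coeff m) h2
  rwa [coeff_map, coeff_zero] at this

variable [IsLocalRing R]

theorem mem_uBar_exists_denominator {y : EBar (R := R) e a} (hy : y ∈ UBar (R := R) e a) :
    ∃ s ∉ extMax R (Idx n e), ∃ p : Fin n → MvPolynomial (Idx n e) R,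
      algebraMap _ (NagataExt R (Idx n e)) s • y =
        (genF (R := R) e a).mkQ (∑ i, algebraMap _ (NagataExt R (Idx n e)) (p i) ⊗ₜ[R] a i) := by
  obtain ⟨t, ht, rfl⟩ := hy
  have h1 : t ∈ Submodule.span (NagataExt R (Idx n e))
      (Set.range fun i => (1 : NagataExt R (Idx n e)) ⊗ₜ[R] a i) := by
    rw [SetLike.mem_coe, Submodule.baseChange_span] at ht
    convert ht using 2
    rw [← Set.range_comp]
    rfl
  obtain ⟨r, hr⟩ := (Submodule.mem_span_range_iff_exists_fun _).1 h1
  obtain ⟨s, hs, p, hp⟩ := exists_nagata_denominator r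
  refine ⟨s, hs, p, ?_⟩
  rw [← map_smul, ← hr, Finset.smul_sum]
  congr 1
  refine Finset.sum_congr rfl fun i _ => ?_
  rw [smul_smul, hp, TensorProduct.smul_tmul', smul_eq_mul, mul_one]

variable [IsNoetherianRing R]

/-- A point of `R'' ⊗ R(E)` over which the generic elements vanish, but which does not vanish on
`E`, induces a point of the Rees algebra of the quotient by the generic elements. In particular it
does not vanish on the preimage of a reduction of the quotient. -/
theorem map_eq_zero_of_isReduction_eBar (hE : HasRank R E e)
    (hU : IsReduction (Submodule.span R (Set.range a)))
    {Ω : Type*} [Field Ω] (ψ : ReesAlg R E →+* Ω) (z : Idx n e → Ω)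
    (hS : ∀ s ∉ extMax R (Idx n e), eval₂ (ψ.comp (algebraMap R _)) z s ≠ 0)
    (hx : ∀ j, ∑ i, z (i, j) * ψ (reesMap R E (a i)) = 0)
    {V : Submodule (NagataExt R (Idx n e)) (EBar (R := R) e a)} (hV : IsReduction V)
    (hVU : V ≤ UBar (R := R) e a)
    (hψ : ∀ p : Fin n → MvPolynomial (Idx n e) R,
      (genF (R := R) e a).mkQ (∑ i, algebraMap _ (NagataExt R (Idx n e)) (p i) ⊗ₜ[R] a i) ∈ V →
      ∑ i, eval₂ (ψ.comp (algebraMap R _)) z (p i) * ψ (reesMap R E (a i)) = 0) (g : E) :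
    ψ (reesMap R E g) = 0 := by
  classical
  by_contra hg
  -- A point killing every a_i kills the reduction they generate, hence `E`.
  obtain ⟨i₀, hi₀⟩ : ∃ i, ψ (reesMap R E (a i)) ≠ 0 := by
    by_contra! h0
    refine hg (map_eq_zero_of_isReduction algebraMap_reesAlg_mem_nonZeroDivisors hU (reesMap R E)
      ψ (fun v hv => ?_) g)
    induction hv using Submodule.span_induction with
    | mem v hv => obtain ⟨i, rfl⟩ := hv; exact h0 i
    | zero => rw [map_zero, map_zero]
    | add v w _ _ hv hw => rw [map_add, map_add, hv, hw, add_zero]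
    | smul c v _ hv => rw [map_smul, Algebra.smul_def, map_mul, hv, mul_zero]
  obtain ⟨D, _, _, π, δ, hδ, c, hc0, hc⟩ := exists_domain_factorization a hE hU ψ i₀ hi₀
  let α : E → D := fun x => π (reesMap R E x)
  let ρ : R →+* D := π.comp (algebraMap R (ReesAlg R E))
  let θ : MvPolynomial (Idx n e) R →+* MvPolynomial (Idx n e) D :=
    solveSubst ρ (fun i => α (a i)) i₀
  let ψ' : MvPolynomial (Idx n e) D →+* Ω :=
    eval₂Hom δ fun p => z p / δ (α (a i₀))
  have hψθ : ∀ p, ψ' (θ p) = eval₂ (ψ.comp (algebraMap R _)) z p := fun p => by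
    have h1 := eval₂_solveSubst ρ (fun i => α (a i)) i₀ δ z (by rw [hδ]; exact hi₀)
      (fun j => by simp only [α, hδ]; exact hx j) p
    have h2 : δ.comp ρ = ψ.comp (algebraMap R _) := RingHom.ext fun r => hδ _
    rw [h2] at h1
    exact h1
  let 𝔮 : Ideal (MvPolynomial (Idx n e) D) := RingHom.ker ψ'
  have h𝔮 : 𝔮.IsPrime := RingHom.ker_isPrime ψ'
  -- The intermediate ring for the point criterion: a domain through which the given point factors,
  -- receiving E''/F, and in which regular elements of R'' stay nonzero.
  obtain ⟨Λ, _, _, _⟩ : ∃ (Λ : Type u) (_ : CommRing Λ) (_ : Algebra (MvPolynomial (Idx n e) D) Λ),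
      IsLocalization.AtPrime Λ 𝔮 := ⟨Localization.AtPrime 𝔮, inferInstance, inferInstance,
        inferInstance⟩
  have hle : 𝔮.primeCompl ≤ nonZeroDivisors (MvPolynomial (Idx n e) D) :=
    Ideal.primeCompl_le_nonZeroDivisors 𝔮
  have : IsDomain Λ := IsLocalization.isDomain_of_le_nonZeroDivisors _ hle
  have hinj : Function.Injective (algebraMap (MvPolynomial (Idx n e) D) Λ) :=
    IsLocalization.injective Λ hle
  let ψΛ : Λ →+* Ω := IsLocalization.lift (M := 𝔮.primeCompl) (g := ψ')
    fun y => isUnit_iff_ne_zero.2 y.2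
  have hψΛ : ∀ y, ψΛ (algebraMap _ Λ y) = ψ' y := fun y => IsLocalization.lift_eq _ y
  let G : NagataExt R (Idx n e) →+* Λ :=
    IsLocalization.lift (M := (extMax R (Idx n e)).primeCompl)
      (g := (algebraMap (MvPolynomial (Idx n e) D) Λ).comp θ)
      fun s => IsLocalization.map_units Λ (⟨θ s, fun h0 => hS s s.2 ((hψθ s).symm.trans h0)⟩ :
        𝔮.primeCompl)
  have hG : ∀ p, G (algebraMap _ _ p) = algebraMap _ Λ (θ p) := fun p => IsLocalization.lift_eq _ p
  let i1 : Algebra (NagataExt R (Idx n e)) Λ := G.toAlgebra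
  let i0 : Algebra R Λ := (G.comp (algebraMap R _)).toAlgebra
  have i2 : IsScalarTower R (NagataExt R (Idx n e)) Λ := IsScalarTower.of_algebraMap_eq fun _ => rfl
  have hreg : ∀ s ∈ nonZeroDivisors (NagataExt R (Idx n e)),
      algebraMap (NagataExt R (Idx n e)) Λ s ∈ nonZeroDivisors Λ := by
    intro s hs
    refine mem_nonZeroDivisors_of_ne_zero fun (h0 : G s = 0) => ?_
    obtain ⟨d, hd, p, hp⟩ := exists_nagata_denominator (fun _ : Unit => s)
    have h1 := congrArg G (hp ())
    rw [map_mul, h0, mul_zero, hG] at h1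
    have h3 := hc (p ()) (hinj (h1.symm.trans (map_zero _).symm))
    have h4 := congrArg (algebraMap _ (NagataExt R (Idx n e))) h3
    rw [map_mul, ← hp, map_zero, ← algebraMap_nagata_apply, mul_assoc, mul_left_comm] at h4
    have h5 := (isUnit_algebraMap_nagata hd).mul_right_eq_zero.1
      ((mul_left_mem_nonZeroDivisors_eq_zero_iff hs).1 h4)
    exact hc0 (algebraMap_nagata_injective (h5.trans (map_zero _).symm))
  have hαsmul : ∀ (r : R) x, α (r • x) = ρ r * α x := fun r x => by
    simp only [α, ρ, map_smul, Algebra.smul_def, map_mul, RingHom.comp_apply]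
  have hρ : ∀ r, algebraMap R Λ r = algebraMap _ Λ (C (ρ r)) := fun r => by
    change G (algebraMap R _ r) = _
    rw [algebraMap_nagata_apply, hG]
    exact congrArg _ (solveSubst_C ρ _ i₀ r)
  let f : E →ₗ[R] Λ :=
    { toFun := fun x => algebraMap (MvPolynomial (Idx n e) D) Λ (C (α x))
      map_add' := fun x y => by simp only [α, map_add]
      map_smul' := fun r x => by
        rw [hαsmul, C_mul, map_mul, ← hρ]
        exact (Algebra.smul_def r _).symm }
  have hf : ∀ x, f x = algebraMap (MvPolynomial (Idx n e) D) Λ (C (α x)) := fun _ => rfl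
  let F := f.liftBaseChange (NagataExt R (Idx n e))
  have hF : ∀ p : Fin n → MvPolynomial (Idx n e) R,
      F (∑ i, algebraMap _ (NagataExt R (Idx n e)) (p i) ⊗ₜ[R] a i) =
        algebraMap _ Λ (∑ i, θ (p i) * C (α (a i))) := by
    intro p
    rw [map_sum, map_sum]
    refine Finset.sum_congr rfl fun i _ => ?_
    rw [LinearMap.liftBaseChange_tmul, Algebra.smul_def, map_mul, hf]
    exact congrArg (· * _) (hG (p i))
  have hFx : genF (R := R) e a ≤ LinearMap.ker F := by
    refine Submodule.span_le.2 ?_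
    rintro _ ⟨j, rfl⟩
    rw [SetLike.mem_coe, LinearMap.mem_ker, genElt]
    refine (hF fun i => X (i, j)).trans ?_
    rw [sum_solveSubst_X, map_zero]
  let F' : EBar (R := R) e a →ₗ[NagataExt R (Idx n e)] Λ := (genF (R := R) e a).liftQ F hFx
  have hF' : ∀ y, F' ((genF (R := R) e a).mkQ y) = F y := fun y => Submodule.liftQ_apply _ _ _
  have hkill := map_eq_zero_of_isReduction hreg hV F' ψΛ (fun y hy => by
    obtain ⟨s, hs, p, hp⟩ := mem_uBar_exists_denominator a (hVU hy)
    have h1 := hψ p (by rw [← hp]; exact V.smul_mem _ hy)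
    have h2 := congrArg (fun y => ψΛ (F' y)) hp
    beta_reduce at h2
    rw [hF', hF, hψΛ, map_smul, Algebra.smul_def, map_mul] at h2
    have h3 : ψΛ (algebraMap (NagataExt R (Idx n e)) Λ (algebraMap _ _ s)) =
        eval₂ (ψ.comp (algebraMap R _)) z s := by
      rw [← hψθ, ← hψΛ, ← hG]
      rfl
    have h4 : ψ' (∑ i, θ (p i) * C (α (a i))) = 0 := by
      rw [← h1, map_sum]
      refine Finset.sum_congr rfl fun i _ => ?_
      rw [map_mul, hψθ]
      congr 1
      exact (eval₂_C _ _ _).trans (hδ _)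
    rw [h4, h3] at h2
    exact (mul_eq_zero.1 h2).resolve_left (hS s hs)) ((genF (R := R) e a).mkQ (1 ⊗ₜ g))
  rw [hF', LinearMap.liftBaseChange_tmul, one_smul, hf, hψΛ] at hkill
  exact hg (((eval₂_C _ _ _).trans (hδ _)).symm.trans hkill)

end QuotientPoints

/-! ### Minimality of U''/F. -/

section Minimality

open MvPolynomial

variable {R : Type u} [CommRing R] [IsLocalRing R] {E : Type u} [AddCommGroup E] [Module R E]
  {e n : ℕ} (a : Fin n → E)

/-- The ideal of `R(E)[Z]` generated by the preimage of a submodule of `E'' / F`. -/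
noncomputable def contractedIdeal
    (V : Submodule (NagataExt R (Idx n e)) (EBar (R := R) e a)) :
    Ideal (MvPolynomial (Idx n e) (ReesAlg R E)) :=
  Ideal.span {y | ∃ p : Fin n → MvPolynomial (Idx n e) R,
    (genF (R := R) e a).mkQ (∑ i, algebraMap _ (NagataExt R (Idx n e)) (p i) ⊗ₜ[R] a i) ∈ V ∧
    ∑ i, MvPolynomial.map (algebraMap R (ReesAlg R E)) (p i) * C (reesMap R E (a i)) = y}

/-- Otherwise some prime contains the ideal and avoids all s and all powers of g. The fraction field
of its quotient is a point that kills everything over `V`, in particular the x_j, but not g. -/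
theorem exists_mul_pow_mem_contractedIdeal [IsNoetherianRing R] (hE : HasRank R E e)
    (hU : IsReduction (Submodule.span R (Set.range a)))
    {V : Submodule (NagataExt R (Idx n e)) (EBar (R := R) e a)} (hV : IsReduction V)
    (hVU : V ≤ UBar (R := R) e a) (g : E) :
    ∃ s ∉ extMax R (Idx n e), ∃ m : ℕ,
      MvPolynomial.map (algebraMap R (ReesAlg R E)) s * C (reesMap R E g) ^ m ∈
        contractedIdeal a V := by
  by_contra! hcon
  let S : Submonoid (MvPolynomial (Idx n e) (ReesAlg R E)) :=
    (extMax R (Idx n e)).primeCompl.map (MvPolynomial.map (algebraMap R (ReesAlg R E))) ⊔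
      Submonoid.powers (C (reesMap R E g))
  have hdisj : Disjoint (contractedIdeal a V : Set (MvPolynomial (Idx n e) (ReesAlg R E))) S := by
    refine Set.disjoint_left.2 fun y hy hyS => ?_
    obtain ⟨_, ⟨s, hs, rfl⟩, _, ⟨m, rfl⟩, rfl⟩ := Submonoid.mem_sup.1 hyS
    exact hcon s hs m hy
  obtain ⟨P, hP, hJP, hPS⟩ := Ideal.exists_le_prime_disjoint _ S hdisj
  let Ω := FractionRing (MvPolynomial (Idx n e) (ReesAlg R E) ⧸ P)
  let Ψ : MvPolynomial (Idx n e) (ReesAlg R E) →+* Ω :=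
    (algebraMap (MvPolynomial (Idx n e) (ReesAlg R E) ⧸ P) Ω).comp (Ideal.Quotient.mk P)
  have hΨ : ∀ y, Ψ y = 0 ↔ y ∈ P := fun y => by
    rw [← Ideal.Quotient.eq_zero_iff_mem]
    exact map_eq_zero_iff _ (IsFractionRing.injective (MvPolynomial _ (ReesAlg R E) ⧸ P) Ω)
  have heval : ∀ p : MvPolynomial (Idx n e) R, eval₂ ((Ψ.comp C).comp (algebraMap R (ReesAlg R E)))
      (fun i => Ψ (X i)) p = Ψ (MvPolynomial.map (algebraMap R _) p) := fun p => by
    rw [← eval₂_map]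
    conv_rhs => rw [← eval₂_eta (MvPolynomial.map (algebraMap R (ReesAlg R E)) p)]
    rw [hom_eval₂]
  have hkill : ∀ p : Fin n → MvPolynomial (Idx n e) R,
      (genF (R := R) e a).mkQ (∑ i, algebraMap _ (NagataExt R (Idx n e)) (p i) ⊗ₜ[R] a i) ∈ V →
      ∑ i, Ψ (MvPolynomial.map (algebraMap R _) (p i)) * Ψ (C (reesMap R E (a i))) = 0 := by
    intro p hp
    have h1 := (hΨ _).2 (hJP (Ideal.subset_span ⟨p, hp, rfl⟩))
    rw [map_sum] at h1
    simpa only [map_mul] using h1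
  have hg := map_eq_zero_of_isReduction_eBar a hE hU (Ψ.comp C) (fun i => Ψ (X i))
    (fun s hs h0 => by
      rw [heval, hΨ] at h0
      exact Set.disjoint_left.1 hPS h0 ((le_sup_left : _ ≤ S) ⟨s, hs, rfl⟩))
    (fun j => by
      have h1 := hkill (fun i => X (i, j)) (by
        have : (genF (R := R) e a).mkQ (genElt (R := R) e a j) = 0 :=
          (Submodule.Quotient.mk_eq_zero _).2 (Submodule.subset_span ⟨j, rfl⟩)
        change (genF (R := R) e a).mkQ (genElt (R := R) e a j) ∈ V
        rw [this]
        exact zero_mem V)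
      simpa only [map_X, RingHom.comp_apply] using h1)
    hV hVU (fun p hp => by
      simp only [heval]
      exact hkill p hp) g
  exact Set.disjoint_left.1 hPS ((hΨ _).1 hg)
    ((le_sup_right : _ ≤ S) (Submonoid.mem_powers _))

/-- A proper submodule of `U'' / F` is detected by a relation modulo the maximal ideal. -/
theorem exists_relation_of_not_uBar_le
    {V : Submodule (NagataExt R (Idx n e)) (EBar (R := R) e a)}
    (hV : ¬ UBar (R := R) e a ≤ V) :
    ∃ q : Fin n → MvPolynomial (Idx n e) R, (∃ i, q i ∉ extMax R (Idx n e)) ∧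
      ∀ p : Fin n → MvPolynomial (Idx n e) R,
        (genF (R := R) e a).mkQ (∑ i, algebraMap _ (NagataExt R (Idx n e)) (p i) ⊗ₜ[R] a i) ∈ V →
        ∑ i, p i * q i ∈ extMax R (Idx n e) := by
  classical
  let N := NagataExt R (Idx n e)
  let lin : (Fin n → N) →ₗ[N] EBar (R := R) e a :=
    (genF (R := R) e a).mkQ ∘ₗ Fintype.linearCombination N fun i => (1 : N) ⊗ₜ[R] a i
  have hlin : ∀ r : Fin n → N, lin r = (genF (R := R) e a).mkQ (∑ i, r i ⊗ₜ[R] a i) := fun r => by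
    simp [lin, Fintype.linearCombination_apply, TensorProduct.smul_tmul']
  have hT : V.comap lin ≠ ⊤ := by
    refine fun hT => hV fun y hy => ?_
    obtain ⟨s, hs, p, hp⟩ := mem_uBar_exists_denominator a hy
    have h1 : (fun i => algebraMap _ N (p i)) ∈ V.comap lin := by rw [hT]; trivial
    rw [Submodule.mem_comap, hlin, ← hp] at h1
    obtain ⟨u, hu⟩ := isUnit_algebraMap_nagata hs
    have h2 := V.smul_mem (↑u⁻¹ : N) h1
    rwa [← hu, smul_smul, Units.inv_mul, one_smul] at h2
  -- The relation `q` is this functional on R''^n, lifted from the residue field and cleared of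
  -- denominators.
  obtain ⟨𝔫, h𝔫, f, hf, hTf⟩ := exists_linearMap_quotient_maximal _ hT
  have h𝔫' : 𝔫 = IsLocalRing.maximalIdeal N := IsLocalRing.eq_maximalIdeal h𝔫
  choose r hr using fun i => Ideal.Quotient.mk_surjective (f (Pi.single i 1))
  have hfr : ∀ x : Fin n → N, f x = Ideal.Quotient.mk 𝔫 (∑ i, x i * r i) := fun x => by
    conv_lhs => rw [pi_eq_sum_univ' x]
    rw [map_sum, map_sum]
    refine Finset.sum_congr rfl fun i _ => ?_
    rw [map_smul, ← hr, map_mul]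
    rfl
  obtain ⟨d, hd, q, hq⟩ := exists_nagata_denominator r
  refine ⟨q, ?_, fun p hp => ?_⟩
  · by_contra! hcon
    refine hf (LinearMap.ext fun x => ?_)
    rw [hfr, LinearMap.zero_apply, Ideal.Quotient.eq_zero_iff_mem, h𝔫']
    refine Ideal.sum_mem _ fun i _ => Ideal.mul_mem_left _ _ ?_
    have h1 := algebraMap_mem_maximalIdeal_nagata.2 (hcon i)
    rw [← hq] at h1
    exact (Ideal.unit_mul_mem_iff_mem _ (isUnit_algebraMap_nagata hd)).1 h1
  · have h1 : (fun i => algebraMap _ N (p i)) ∈ V.comap lin := by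
      rw [Submodule.mem_comap, hlin]; exact hp
    have h2 := hTf h1
    rw [LinearMap.mem_ker, hfr, Ideal.Quotient.eq_zero_iff_mem, h𝔫'] at h2
    rw [← algebraMap_mem_maximalIdeal_nagata, map_sum]
    have h3 := Ideal.mul_mem_left _ (algebraMap _ N d) h2
    rw [Finset.mul_sum] at h3
    convert h3 using 2 with i
    rw [map_mul, ← hq]
    ring

theorem isMinimalReduction_uBar [IsNoetherianRing R] [Module.Finite R E]
    [Infinite (IsLocalRing.ResidueField R)] (hE : HasRank R E e)
    (hU : IsMinimalReduction (Submodule.span R (Set.range a))) :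
    IsMinimalReduction (UBar (R := R) e a) := by
  classical
  refine ⟨isReduction_uBar a hU.1, fun V hV hVU => ?_⟩
  by_contra hne
  obtain ⟨q, ⟨i₀, hi₀⟩, hq⟩ := exists_relation_of_not_uBar_le a hne
  obtain ⟨G, hG⟩ := Module.Finite.fg_top (R := R) (M := E)
  choose s hs m hm using exists_mul_pow_mem_contractedIdeal a hE hU.1 hV hVU
  -- One polynomial collects every condition on the specialization; since k is infinite, some point
  -- of R makes all its factors units.
  have hH : (∏ g ∈ G, s g) * q i₀ ∉ extMax R (Idx n e) := by
    intro hmem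
    rcases (extMax_isPrime R (Idx n e)).mem_or_mem hmem with h1 | h1
    · obtain ⟨g, -, h2⟩ := ((extMax_isPrime R (Idx n e)).prod_mem_iff).1 h1
      exact hs g h2
    · exact hi₀ h1
  obtain ⟨ζ, hζ⟩ := exists_eval_notMem_maximalIdeal hH
  rw [map_mul, map_prod] at hζ
  have hζs : ∀ g ∈ G, eval ζ (s g) ∉ IsLocalRing.maximalIdeal R := fun g hg h0 =>
    hζ (Ideal.mul_mem_right _ _ (Ideal.mem_of_dvd _ (Finset.dvd_prod_of_mem _ hg) h0))
  have hζq : eval ζ (q i₀) ∉ IsLocalRing.maximalIdeal R := fun h0 => hζ (Ideal.mul_mem_left _ _ h0)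
  let lin : (Fin n → R) →ₗ[R] E := Fintype.linearCombination R a
  have hlin : ∀ c, lin c = ∑ i, c i • a i := fun c => Fintype.linearCombination_apply R a c
  let wt : (Fin n → R) →ₗ[R] R := Fintype.linearCombination R fun i => eval ζ (q i)
  have hwt : ∀ c, wt c = ∑ i, c i * eval ζ (q i) := fun c => Fintype.linearCombination_apply R _ c
  -- The combinations of the a_i whose coefficients satisfy the specialized relation modulo m;
  -- elements over `V` specialize into it.
  let V₀ : Submodule R E := (Submodule.comap wt (IsLocalRing.maximalIdeal R)).map lin
  have hV₀U : V₀ ≤ Submodule.span R (Set.range a) := by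
    rw [← Fintype.range_linearCombination]
    exact LinearMap.map_le_range
  let ε : MvPolynomial (Idx n e) (ReesAlg R E) →+* ReesAlg R E :=
    eval₂Hom (RingHom.id _) fun i => algebraMap R _ (ζ i)
  have hε : ∀ p, ε (MvPolynomial.map (algebraMap R _) p) = algebraMap R _ (eval ζ p) := fun p => by
    rw [coe_eval₂Hom, eval₂_map, RingHom.id_comp]
    exact (eval₂_comp (algebraMap R (ReesAlg R E)) ζ p).symm
  have hεC : ∀ y, ε (C y) = y := fun y => eval₂_C _ _ _
  have hJ : contractedIdeal a V ≤
      (Ideal.span (reesMap R E '' (V₀ : Set E))).comap ε := by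
    refine Ideal.span_le.2 ?_
    rintro _ ⟨p, hp, rfl⟩
    refine Ideal.subset_span ⟨lin fun i => eval ζ (p i), ?_, ?_⟩
    · refine Submodule.mem_map_of_mem ?_
      rw [Submodule.mem_comap, hwt]
      have := eval_mem_maximalIdeal ζ (hq p hp)
      simpa only [map_sum, map_mul] using this
    · rw [hlin, map_sum, map_sum]
      refine Finset.sum_congr rfl fun i _ => ?_
      rw [map_mul, hε, map_smul, Algebra.smul_def]
      congr 1
      exact (hεC _).symm
  have hrad : ∀ x : E, reesMap R E x ∈ (Ideal.span (reesMap R E '' (V₀ : Set E))).radical := by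
    intro x
    have hx : x ∈ Submodule.span R (G : Set E) := by rw [hG]; trivial
    induction hx using Submodule.span_induction with
    | mem g hg =>
      have h1 := hJ (hm g)
      rw [Ideal.mem_comap, map_mul, map_pow, hε] at h1
      have hu : IsUnit (algebraMap R (ReesAlg R E) (eval ζ (s g))) :=
        (IsLocalRing.notMem_maximalIdeal.1 (hζs g hg)).map _
      refine ⟨m g, ?_⟩
      have h2 := (Ideal.unit_mul_mem_iff_mem _ hu).1 h1
      rwa [hεC] at h2
    | zero => rw [map_zero]; exact zero_mem _
    | add x y _ _ hx hy => rw [map_add]; exact add_mem hx hy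
    | smul c x _ hx =>
      rw [map_smul, Algebra.smul_def]
      exact Ideal.mul_mem_left _ _ hx
  have hle := hU.2 (isReduction_of_pow_mem V₀ hrad) hV₀U
  obtain ⟨c, hc, hca⟩ := hle (Submodule.subset_span ⟨i₀, rfl⟩)
  rw [SetLike.mem_coe, Submodule.mem_comap, hwt] at hc
  rw [hlin] at hca
  -- Minimality writes a_i₀ as Σ c_i a_i with `c` satisfying the relation. Thus `d` is a syzygy of
  -- the a_i; it represents 0 in `V`, so it also satisfies the relation, which forces q_i₀(ζ) into
  -- m.
  let d : Fin n → R := c - Pi.single i₀ 1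
  have h1 := hq (fun i => C (d i)) (by
    have h2 : ∑ i, algebraMap (MvPolynomial (Idx n e) R) (NagataExt R (Idx n e)) (C (d i)) ⊗ₜ[R]
        a i = (1 : NagataExt R (Idx n e)) ⊗ₜ[R] ∑ i, d i • a i := by
      rw [TensorProduct.tmul_sum]
      refine Finset.sum_congr rfl fun i _ => ?_
      rw [← algebraMap_nagata_apply, TensorProduct.tmul_smul, TensorProduct.smul_tmul',
        Algebra.smul_def, mul_one]
    have h3 : ∑ i, d i • a i = 0 := by
      simp [d, sub_smul, Finset.sum_sub_distrib, hca, Pi.single_apply]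
    rw [h2, h3, TensorProduct.tmul_zero, map_zero]
    exact zero_mem V)
  have h4 := eval_mem_maximalIdeal ζ h1
  rw [map_sum] at h4
  refine hζq ?_
  have h5 : eval ζ (q i₀) = ∑ i, c i * eval ζ (q i) -
      ∑ i, eval ζ (C (d i) * q i) := by
    simp only [map_mul, eval_C, d, Pi.sub_apply, sub_mul, Finset.sum_sub_distrib]
    simp [Pi.single_apply]
  rw [h5]
  exact sub_mem hc h4

end Minimality

end GenericQuotient

theorem theorem4p5 {R : Type u} [CommRing R] [IsLocalRing R] [IsNoetherianRing R]
    {E : Type u} [AddCommGroup E] [Module R E] [Module.Finite R E]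
    (e : ℕ) (he : 2 ≤ e) (hE : GenericQuotient.HasRank R E e)
    {n : ℕ} (a : Fin n → E) (U : Submodule R E) (hUa : U = Submodule.span R (Set.range a))
    (hU : GenericQuotient.IsReduction U) :
    LinearIndependent (GenericQuotient.NagataExt R (GenericQuotient.Idx n e))
      (GenericQuotient.genElt (R := R) e a) ∧
    ((GenericQuotient.mu (GenericQuotient.NagataExt R (GenericQuotient.Idx n e))
        (GenericQuotient.EBar (R := R) e a) : ℤ) = (GenericQuotient.mu R E : ℤ) - (e : ℤ) + 1) ∧
    (Module.Free (GenericQuotient.NagataExt R (GenericQuotient.Idx n e))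
        (GenericQuotient.EBar (R := R) e a) ↔ Module.Free R E) ∧
    ((GenericQuotient.projDim (GenericQuotient.NagataExt R (GenericQuotient.Idx n e))
        (GenericQuotient.EBar (R := R) e a) ≠ ⊤ ↔ GenericQuotient.projDim R E ≠ ⊤) ∧
      (GenericQuotient.projDim R E ≠ ⊤ →
        GenericQuotient.projDim (GenericQuotient.NagataExt R (GenericQuotient.Idx n e))
          (GenericQuotient.EBar (R := R) e a) = GenericQuotient.projDim R E)) ∧
    (Module.IsTorsionFree R E → Infinite (IsLocalRing.ResidueField R) →
      GenericQuotient.IsMinimalReduction U →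
      GenericQuotient.IsMinimalReduction (GenericQuotient.UBar (R := R) e a)) := by
  subst hUa
  have hpd := GenericQuotient.projDim_eBar a (by omega) hE hU
  refine ⟨GenericQuotient.linearIndependent_genElt e a hE hU, ?_,
    GenericQuotient.free_eBar_iff a hE hU, ⟨by rw [hpd], fun _ => hpd⟩,
    fun _ _ hmin => GenericQuotient.isMinimalReduction_uBar a hE hmin⟩
  have h := GenericQuotient.mu_eBar_add a hE hU
  omega
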